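/- Let $n,p,m\ge 1$ be integers with $n\ge 2p$ and let $\sigma>0$. Consider $Y=\Pi^*XB^*+W\in\mathbb{R}^{n\times m}$, where $\Pi^*$ is a fixed unknown $n\times n$ permutation matrix, $B^*\in\mathbb{R}^{p\times m}$ is a fixed unknown matrix, $X\in\mathbb{R}^{n\times p}$ has i.i.d. $\mathcal N(0,1)$ entries, and $W\in\mathbb{R}^{n\times m}$ has i.i.d. $\mathcal N(0,\sigma^2)$ entries and is independent of $X$. Let $d_H(\Pi_1,\Pi_2)=\#\{i:\pi_1(i)\ne\pi_2(i)\}$ be the Hamming distance between the permutations $\pi_1,\pi_2$ associated with the permutation matrices $\Pi_1,\Pi_2$, and put $\mathrm{snr}=\|B^*\|_F^2/(m\sigma^2)$ and $\varrho(B^*)=\|B^*\|_F^2/\|B^*\|_{\mathrm{op}}^2$ (the stable rank). There are universal constants $c_0,c_1,c_3,c_4>0$ such that for every $\varepsilon>0$ there is a constant $N_2(\varepsilon)>0$, depending only on $\varepsilon$, with the following property. Suppose that $n>N_2(\varepsilon)$, that $d_H(I,\Pi^*)\le h_{\max}$, where the integer $h_{\max}\ge 0$ satisfies $h_{\max}\cdot\mathrm{rank}(B^*)\le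 n/8$, and that $$\text{(i) }\mathrm{snr}>c_0,\qquad \text{(ii) }\varrho(B^*)\ge c_1(1+\varepsilon)\log n,\qquad \text{(iii) }\log(\mathrm{snr})\ge \frac{c_3(1+\varepsilon)\log n}{\varrho(B^*)}+c_4 .$$ Then, with probability at least $$1-10\,n^{-\varepsilon}\left[(n^{\varepsilon}-1)^{-1}\vee 1\right],$$ the maximum likelihood estimator of the permutation matrix subject to the constraint $d_H(I,\Pi)\le h_{\max}$, that is, the $\Pi$-component of a minimizer $(\widehat\Pi,\widehat B)$ of $\|Y-\Pi XB\|_F^2$ over all permutation matrices $\Pi$ with $d_H(I,\Pi)\le h_{\max}$ and all $B\in\mathbb{R}^{p\times m}$, is uniquely determined and equals $\Pi^*$. -/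

import Mathlib

open MeasureTheory ProbabilityTheory
open scoped NNReal

noncomputable section

namespace PermRegression

/-- The squared Frobenius norm of a real matrix. -/
def frobSq {a b : ℕ} (A : Matrix (Fin a) (Fin b) ℝ) : ℝ :=
  ∑ i, ∑ j, A i j ^ 2

open scoped Matrix.Norms.L2Operator in
/-- The operator norm (largest singular value) of a real matrix, with respect to the Euclidean
norms. -/
def opNorm {a b : ℕ} (A : Matrix (Fin a) (Fin b) ℝ) : ℝ := ‖A‖

/-- The stable rank: squared Frobenius norm over squared operator norm. -/
def stableRank {a b : ℕ} (A : Matrix (Fin a) (Fin b) ℝ) : ℝ :=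
  frobSq A / opNorm A ^ 2

/-- The signal-to-noise ratio of the signal matrix `B` at noise variance `σ ^ 2`. -/
def snr {p m : ℕ} (B : Matrix (Fin p) (Fin m) ℝ) (σ : ℝ≥0) : ℝ :=
  frobSq B / (m * (σ : ℝ) ^ 2)

/-- The observed matrix `Π X B + W`, where `Π` is the permutation matrix of `π`. -/
def observe {n p m : ℕ} (π : Equiv.Perm (Fin n)) (X : Matrix (Fin n) (Fin p) ℝ)
    (B : Matrix (Fin p) (Fin m) ℝ) (W : Matrix (Fin n) (Fin m) ℝ) :
    Matrix (Fin n) (Fin m) ℝ :=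
  π.permMatrix ℝ * X * B + W

/-- The permutations whose Hamming distance from the identity is at most `h`. -/
def hammingBall (n h : ℕ) : Set (Equiv.Perm (Fin n)) :=
  {π | hammingDist (⇑(1 : Equiv.Perm (Fin n))) (⇑π) ≤ h}

/-- `(π, B)` minimizes the least squares criterion `‖Y - Π X B‖²` (Frobenius norm) over all pairs
of a permutation in the Hamming ball of radius `h` around the identity and a matrix `B`. -/
def IsRestrictedML {n p m : ℕ} (h : ℕ) (X : Matrix (Fin n) (Fin p) ℝ)
    (Y : Matrix (Fin n) (Fin m) ℝ) (π : Equiv.Perm (Fin n))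
    (B : Matrix (Fin p) (Fin m) ℝ) : Prop :=
  π ∈ hammingBall n h ∧
    ∀ π' ∈ hammingBall n h, ∀ B' : Matrix (Fin p) (Fin m) ℝ,
      frobSq (Y - π.permMatrix ℝ * X * B) ≤ frobSq (Y - π'.permMatrix ℝ * X * B')

/-- The set of all values of the restricted maximum likelihood estimator of the permutation:
the permutation components of the minimizing pairs. -/
def restrictedMLPerms {n p m : ℕ} (h : ℕ) (X : Matrix (Fin n) (Fin p) ℝ)
    (Y : Matrix (Fin n) (Fin m) ℝ) : Set (Equiv.Perm (Fin n)) :=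
  {π | ∃ B : Matrix (Fin p) (Fin m) ℝ, IsRestrictedML h X Y π B}

/-- The entries of the random matrices `X` and `W` are jointly independent, those of `X` standard
normal and those of `W` centred normal with variance `σ ^ 2`. -/
structure IsGaussianDesign {Ω : Type*} [MeasurableSpace Ω] (P : Measure Ω) {n p m : ℕ}
    (σ : ℝ≥0) (X : Ω → Matrix (Fin n) (Fin p) ℝ) (W : Ω → Matrix (Fin n) (Fin m) ℝ) :
    Prop where
  indep : iIndepFun
    (fun (k : (Fin n × Fin p) ⊕ (Fin n × Fin m)) (ω : Ω) =>
      Sum.elim (fun e => X ω e.1 e.2) (fun e => W ω e.1 e.2) k) P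
  law_X : ∀ i j, HasLaw (fun ω => X ω i j) (gaussianReal 0 1) P
  law_W : ∀ i j, HasLaw (fun ω => W ω i j) (gaussianReal 0 (σ ^ 2)) P

end PermRegression

end

/-!
After relabelling the rows of `X` the true permutation is the identity and the competitors are
`τ = π₀⁻¹ * π`; let `d` be the number of points moved by `τ`. The competitor `τ` is excluded if the
observation `y = X B + W` is strictly closer to the space `U₀` of the matrices `X B'` than to the
space `U` of the matrices `Π X B'`. Writing `T` for the part of `X B` orthogonal to `U`, three facts
give this with failure probability at most `5 q ^ d`, where `q = n ^ (-3 (1 + ε))`.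

* Deterministic part (`frobSq_sub_le_mul_frobSq`): `‖T‖` is comparable to the displacement
  `‖X B - Π X B‖`. Replacing `B` by another coefficient matrix to reduce the misfit on the moved
  rows creates a misfit on the fixed rows, because the fixed rows alone, at least `3 n / 4` in number
  against `p ≤ n / 2` columns, control the length of every `X v`
  (`stdGaussian_real_not_sum_mulVec_sq_le`, by nets on the sphere and Chernoff bounds).
* The displacement satisfies `‖X B - Π X B‖² ≥ d ‖B‖² / 6` outside an event of probability
  `exp (-d ρ(B) / 24)` (`stdGaussian_real_not_le_frobSq_sub`), since a third of the moved rows is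
  displaced independently and `ρ(B)` is the effective number of degrees of freedom of each row.
* Conditionally on `X`, the noise can only reverse the comparison through its component along `T` or
  through the part of `U` orthogonal to `U ⊓ U₀`, whose dimension is at most `d m`
  (`stdGaussian_real_infDist_le`, `finrank_range_le_inf_add`). As `‖T‖²` exceeds a large multiple of
  `d m σ²` when the signal-to-noise ratio is large, this has probability at most `2 exp (-d m)`, and
  `m ≥ ρ(B)`.

The lower bound on `ρ(B)` is a large multiple of `(1 + ε) log n`, and `ρ(B) ≤ rank B` turns the
constraint on the Hamming radius into `d (1 + ε) log n ≤ n / 288`; both make the exponential terms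
smaller than `q ^ d`. The union bound is `∑_{τ ≠ 1} q ^ d(τ) ≤ (1 + n q) ^ n - 1 ≤ 2 n² q`.

All Gaussian estimates are instances of one Chernoff bound for diagonal quadratic forms in an
orthonormal system (`stdGaussian_real_le_sum_mul_inner_sq`).
-/

open scoped RealInnerProductSpace Matrix

namespace PermRegression

/-! ### Quadratic forms of Gaussian vectors -/

open Real in
lemma integrable_and_integral_exp_mul_sq_gaussianReal {a : ℝ} (ha : a < 1 / 2) :
    Integrable (fun x : ℝ => exp (a * x ^ 2)) (gaussianReal 0 1) ∧
      ∫ x, exp (a * x ^ 2) ∂(gaussianReal 0 1) = exp (-(1 / 2) * log (1 - 2 * a)) := by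
  have hb : 0 < 1 / 2 - a := by linarith
  have h1 : ∀ x : ℝ, gaussianPDFReal 0 1 x * exp (a * x ^ 2)
      = (√(2 * π))⁻¹ * exp (-(1 / 2 - a) * x ^ 2) := by
    intro x
    rw [gaussianPDFReal]
    simp only [NNReal.coe_one, mul_one, sub_zero]
    rw [mul_assoc, ← exp_add]
    congr 2
    ring
  constructor
  · rw [gaussianReal_of_var_ne_zero _ one_ne_zero,
      integrable_withDensity_iff_integrable_smul₀' (by fun_prop) (by simp [gaussianPDF])]
    have : (fun x : ℝ => (gaussianPDF 0 1 x).toReal • exp (a * x ^ 2))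
        = fun x => (√(2 * π))⁻¹ * exp (-(1 / 2 - a) * x ^ 2) := by
      ext x
      rw [gaussianPDF, ENNReal.toReal_ofReal (gaussianPDFReal_nonneg _ _ _), smul_eq_mul, h1]
    rw [this]
    exact (integrable_exp_neg_mul_sq hb).const_mul _
  · rw [integral_gaussianReal_eq_integral_smul one_ne_zero]
    simp only [smul_eq_mul, h1]
    rw [integral_const_mul, integral_gaussian]
    have h2 : 0 < 1 - 2 * a := by linarith
    have h3 : exp (1 / 2 * log (1 - 2 * a)) = √(1 - 2 * a) := by
      rw [sqrt_eq_rpow, rpow_def_of_pos h2, mul_comm]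
    rw [neg_mul, exp_neg, h3, ← sqrt_inv, ← sqrt_inv, ← sqrt_mul (by positivity)]
    congr 1
    have := pi_pos
    field_simp

section

variable {E : Type*} [NormedAddCommGroup E] [InnerProductSpace ℝ E] [FiniteDimensional ℝ E]
  [MeasurableSpace E] [BorelSpace E]

lemma map_inner_stdGaussian {ι : Type*} [Fintype ι] {v : ι → E} (hv : Orthonormal ℝ v) :
    (stdGaussian E).map (fun x i => ⟪v i, x⟫) = Measure.pi fun _ : ι => gaussianReal 0 1 := by
  have hm : Measurable (fun (x : E) (i : ι) => ⟪v i, x⟫) := by fun_prop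
  have key : ((stdGaussian E).map (fun x i => ⟪v i, x⟫)).map (WithLp.toLp 2)
      = stdGaussian (EuclideanSpace ℝ ι) := by
    rw [Measure.map_map (by fun_prop) hm]
    apply Measure.ext_of_charFun
    ext t
    rw [charFun_stdGaussian, charFun_apply, integral_map (by fun_prop) (by fun_prop)]
    have h1 : ∀ x : E, ⟪(WithLp.toLp 2 (fun i => ⟪v i, x⟫) : EuclideanSpace ℝ ι), t⟫
        = ⟪x, ∑ i, t i • v i⟫ := by
      intro x
      rw [PiLp.inner_apply, inner_sum]
      refine Finset.sum_congr rfl fun i _ => ?_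
      simp [inner_smul_right, real_inner_comm, mul_comm]
    have h2 : ‖∑ i, t i • v i‖ ^ 2 = ‖t‖ ^ 2 := by
      rw [← real_inner_self_eq_norm_sq, hv.inner_sum, EuclideanSpace.real_norm_sq_eq]
      simp [sq]
    simp only [Function.comp_apply, h1]
    rw [← charFun_apply, charFun_stdGaussian]
    norm_cast
    rw [h2]
  have h4 : ∀ μ : Measure (ι → ℝ),
      (μ.map (WithLp.toLp 2)).map (MeasurableEquiv.toLp 2 (ι → ℝ)).symm = μ := by
    intro μ
    rw [Measure.map_map (by fun_prop) (by fun_prop)]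
    exact Measure.map_id
  rw [← h4 ((stdGaussian E).map _), key, ← map_pi_eq_stdGaussian, h4]

lemma pi_gaussianReal_real_le_sum_mul_sq {ι : Type*} [Fintype ι] {a : ι → ℝ}
    (ha : ∀ i, a i < 1 / 2) (t : ℝ) :
    (Measure.pi fun _ : ι => gaussianReal 0 1).real {y | t ≤ ∑ i, a i * y i ^ 2} ≤
      Real.exp (-t - 1 / 2 * ∑ i, Real.log (1 - 2 * a i)) := by
  have hprod : ∀ y : ι → ℝ, Real.exp (1 * ∑ i, a i * y i ^ 2) = ∏ i, Real.exp (a i * y i ^ 2) := by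
    intro y
    rw [one_mul, Real.exp_sum]
  have hint : Integrable (fun y : ι → ℝ => Real.exp (1 * ∑ i, a i * y i ^ 2))
      (Measure.pi fun _ : ι => gaussianReal 0 1) := by
    rw [funext hprod]
    exact Integrable.fintype_prod (μ := fun _ => gaussianReal 0 1)
      (f := fun i x => Real.exp (a i * x ^ 2))
      (fun i => (integrable_and_integral_exp_mul_sq_gaussianReal (ha i)).1)
  have h2 : mgf (fun y => ∑ i, a i * y i ^ 2) (Measure.pi fun _ : ι => gaussianReal 0 1) 1
      = ∏ i, Real.exp (-(1 / 2) * Real.log (1 - 2 * a i)) := by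
    rw [mgf, funext hprod,
      integral_fintype_prod_eq_prod (f := fun i x => Real.exp (a i * x ^ 2))]
    exact Finset.prod_congr rfl fun i _ =>
      (integrable_and_integral_exp_mul_sq_gaussianReal (ha i)).2
  have h3 : (Measure.pi fun _ : ι => gaussianReal 0 1).real {y | t ≤ ∑ i, a i * y i ^ 2} ≤
      Real.exp (-1 * t) *
        mgf (fun y => ∑ i, a i * y i ^ 2) (Measure.pi fun _ : ι => gaussianReal 0 1) 1 :=
    measure_ge_le_exp_mul_mgf t zero_le_one hint
  have h4 : -1 * t + ∑ i, -(1 / 2) * Real.log (1 - 2 * a i)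
      = -t - 1 / 2 * ∑ i, Real.log (1 - 2 * a i) := by
    rw [← Finset.mul_sum]
    ring
  rwa [h2, ← Real.exp_sum, ← Real.exp_add, h4] at h3

/-- Chernoff bound for a diagonal quadratic form of a standard Gaussian vector. The coefficients
may have either sign, so this covers upper and lower deviations at once. -/
lemma stdGaussian_real_le_sum_mul_inner_sq {ι : Type*} [Fintype ι] {v : ι → E}
    (hv : Orthonormal ℝ v) {a : ι → ℝ} (ha : ∀ i, a i < 1 / 2) (t : ℝ) :
    (stdGaussian E).real {x | t ≤ ∑ i, a i * ⟪v i, x⟫ ^ 2} ≤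
      Real.exp (-t - 1 / 2 * ∑ i, Real.log (1 - 2 * a i)) := by
  have hm : Measurable (fun (x : E) (i : ι) => ⟪v i, x⟫) := by fun_prop
  have hset : MeasurableSet {y : ι → ℝ | t ≤ ∑ i, a i * y i ^ 2} :=
    measurableSet_le measurable_const (by fun_prop)
  refine le_trans (le_of_eq ?_) (pi_gaussianReal_real_le_sum_mul_sq ha t)
  rw [← map_inner_stdGaussian hv, map_measureReal_apply hm hset]
  rfl

end

/-! ### Nets on the Euclidean sphere -/

open Metric in
/-- Volumetric bound: an `η`-separated subset of the unit ball has at most `(1 + 2 / η) ^ dim`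
elements. -/
lemma card_le_of_separated_unitBall {E : Type*} [NormedAddCommGroup E] [NormedSpace ℝ E]
    [FiniteDimensional ℝ E] {η : ℝ} (hη : 0 < η) (s : Finset E) (hs : ∀ c ∈ s, ‖c‖ ≤ 1)
    (h : ∀ c ∈ s, ∀ d ∈ s, c ≠ d → η ≤ ‖c - d‖) :
    (s.card : ℝ) ≤ (1 + 2 / η) ^ Module.finrank ℝ E := by
  borelize E
  let μ : Measure E := Measure.addHaar
  have hδ : 0 < η / 2 := by positivity
  have hρ : 0 < 1 + η / 2 := by positivity
  have hD : Set.PairwiseDisjoint (s : Set E) (fun c => ball c (η / 2)) := by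
    intro c hc d hd hcd
    apply ball_disjoint_ball
    rw [dist_eq_norm]
    linarith [h c hc d hd hcd]
  have hsub : (⋃ c ∈ s, ball c (η / 2)) ⊆ ball (0 : E) (1 + η / 2) := by
    refine Set.iUnion₂_subset fun x hx => ball_subset_ball' ?_
    rw [dist_zero_right]
    linarith [hs x hx]
  have hvol : (s.card : ENNReal) * ENNReal.ofReal ((η / 2) ^ Module.finrank ℝ E) * μ (ball 0 1) ≤
      ENNReal.ofReal ((1 + η / 2) ^ Module.finrank ℝ E) * μ (ball 0 1) :=
    calc
      _ = μ (⋃ c ∈ s, ball c (η / 2)) := by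
        rw [measure_biUnion_finset hD fun c _ => measurableSet_ball]
        simp only [μ.addHaar_ball_of_pos _ hδ, Finset.sum_const, nsmul_eq_mul, mul_assoc]
      _ ≤ μ (ball (0 : E) (1 + η / 2)) := measure_mono hsub
      _ = _ := by rw [μ.addHaar_ball_of_pos _ hρ]
  have hJ := (ENNReal.mul_le_mul_iff_left (measure_ball_pos μ _ zero_lt_one).ne'
    measure_ball_lt_top.ne).1 hvol
  have hK := ENNReal.toReal_le_of_le_ofReal (by positivity) hJ
  rw [ENNReal.toReal_mul, ENNReal.toReal_ofReal (by positivity), ENNReal.toReal_natCast] at hK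
  have heq : 1 + 2 / η = (1 + η / 2) / (η / 2) := by field_simp; ring
  rw [heq, div_pow, le_div_iff₀ (by positivity)]
  exact hK

/-- The net is a maximal `η`-separated subset of the sphere. -/
lemma exists_sphere_net {E : Type*} [NormedAddCommGroup E] [NormedSpace ℝ E]
    [FiniteDimensional ℝ E] {η : ℝ} (hη : 0 < η) :
    ∃ N : Finset E, (∀ c ∈ N, ‖c‖ = 1) ∧ (N.card : ℝ) ≤ (1 + 2 / η) ^ Module.finrank ℝ E ∧
      ∀ v : E, ‖v‖ = 1 → ∃ c ∈ N, ‖v - c‖ ≤ η := by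
  classical
  let P : ℕ → Prop := fun k => ∃ s : Finset E, s.card = k ∧ (∀ c ∈ s, ‖c‖ = 1) ∧
    ∀ c ∈ s, ∀ d ∈ s, c ≠ d → η ≤ ‖c - d‖
  have hbound : ∀ k, P k → k ≤ ⌊(1 + 2 / η) ^ Module.finrank ℝ E⌋₊ := by
    rintro k ⟨s, rfl, h1, h2⟩
    exact Nat.le_floor (card_le_of_separated_unitBall hη s (fun c hc => (h1 c hc).le) h2)
  have h0 : P 0 := ⟨∅, by simp⟩
  obtain ⟨N, hcard, h1, h2⟩ := Nat.findGreatest_spec (P := P) (Nat.zero_le _) h0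
  refine ⟨N, h1, card_le_of_separated_unitBall hη N (fun c hc => (h1 c hc).le) h2, ?_⟩
  intro v hv
  -- a unit vector far from a maximal separated set could be added to it
  by_contra! hfar
  have hvN : v ∉ N := fun hmem => by
    have := hfar v hmem
    simp only [sub_self, norm_zero] at this
    linarith
  have hP : P (N.card + 1) := by
    refine ⟨insert v N, Finset.card_insert_of_notMem hvN, ?_, ?_⟩
    · intro c hc
      rcases Finset.mem_insert.1 hc with rfl | hc
      exacts [hv, h1 c hc]
    · intro c hc d hd hcd
      rcases Finset.mem_insert.1 hc with hc' | hc' <;>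
        rcases Finset.mem_insert.1 hd with hd' | hd'
      · exact absurd (hc'.trans hd'.symm) hcd
      · rw [hc']
        exact (hfar d hd').le
      · rw [hd', norm_sub_rev]
        exact (hfar c hc').le
      · exact h2 c hc' d hd' hcd
  have hle := Nat.le_findGreatest (hbound _ hP) hP
  exact absurd (hle.trans_eq hcard.symm) (by simp)

/-- A linear map bounded by `C` on a `1/2`-net of the sphere is bounded by `2 C`. -/
lemma norm_le_of_half_net {E F : Type*} [NormedAddCommGroup E] [NormedSpace ℝ E]
    [FiniteDimensional ℝ E] [NormedAddCommGroup F] [NormedSpace ℝ F] (A : E →ₗ[ℝ] F)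
    {N : Finset E} (hN : ∀ v : E, ‖v‖ = 1 → ∃ c ∈ N, ‖v - c‖ ≤ 1 / 2) {C : ℝ} (hC : 0 ≤ C)
    (hA : ∀ c ∈ N, ‖A c‖ ≤ C) (v : E) : ‖A v‖ ≤ 2 * C * ‖v‖ := by
  set A' := LinearMap.toContinuousLinearMap A with hA'
  have hAv : ∀ v, A' v = A v := fun v => rfl
  have h1 : ‖A'‖ ≤ C + ‖A'‖ * (1 / 2) := by
    refine ContinuousLinearMap.opNorm_le_of_unit_norm (by positivity) fun v hv => ?_
    obtain ⟨c, hc, hvc⟩ := hN v hv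
    calc ‖A' v‖ = ‖A' c + A' (v - c)‖ := by rw [← map_add]; simp
      _ ≤ ‖A' c‖ + ‖A' (v - c)‖ := norm_add_le _ _
      _ ≤ C + ‖A'‖ * (1 / 2) := add_le_add (hA c hc)
        ((A'.le_opNorm _).trans (by gcongr))
  rw [← hAv]
  refine (A'.le_opNorm v).trans ?_
  gcongr
  linarith

/-! ### Matrices as Euclidean vectors -/

/-- A matrix as a vector of the Euclidean space of its entries, so that the Frobenius norm becomes
the Euclidean norm. -/
def vec {a b : ℕ} (M : Matrix (Fin a) (Fin b) ℝ) : EuclideanSpace ℝ (Fin a × Fin b) :=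
  WithLp.toLp 2 fun e => M e.1 e.2

/-- The matrix whose vector of entries is `x`. -/
def unvec {a b : ℕ} (x : EuclideanSpace ℝ (Fin a × Fin b)) : Matrix (Fin a) (Fin b) ℝ :=
  Matrix.of fun i j => x (i, j)

variable {a b : ℕ}

@[simp] lemma vec_apply (M : Matrix (Fin a) (Fin b) ℝ) (e : Fin a × Fin b) :
    vec M e = M e.1 e.2 := rfl

@[simp] lemma unvec_apply (x : EuclideanSpace ℝ (Fin a × Fin b)) (i : Fin a) (j : Fin b) :
    unvec x i j = x (i, j) := rfl

@[simp] lemma unvec_vec (M : Matrix (Fin a) (Fin b) ℝ) : unvec (vec M) = M := rfl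

lemma inner_vec (M : Matrix (Fin a) (Fin b) ℝ) (x : EuclideanSpace ℝ (Fin a × Fin b)) :
    ⟪vec M, x⟫ = ∑ i, ∑ j, M i j * unvec x i j := by
  rw [PiLp.inner_apply, Fintype.sum_prod_type]
  simp [mul_comm]

lemma norm_vec_sq (M : Matrix (Fin a) (Fin b) ℝ) : ‖vec M‖ ^ 2 = frobSq M := by
  rw [← real_inner_self_eq_norm_sq, inner_vec, frobSq]
  simp [sq]

lemma inner_vec_vecMulVec (u : Fin a → ℝ) (v : Fin b → ℝ)
    (x : EuclideanSpace ℝ (Fin a × Fin b)) :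
    ⟪vec (Matrix.vecMulVec u v), x⟫ = u ⬝ᵥ (unvec x *ᵥ v) := by
  rw [inner_vec, dotProduct]
  refine Finset.sum_congr rfl fun i _ => ?_
  rw [Matrix.mulVec, dotProduct, Finset.mul_sum]
  refine Finset.sum_congr rfl fun j _ => ?_
  rw [Matrix.vecMulVec_apply]
  ring

lemma inner_vec_vecMulVec_vecMulVec (u u' : Fin a → ℝ) (v v' : Fin b → ℝ) :
    ⟪vec (Matrix.vecMulVec u v), vec (Matrix.vecMulVec u' v')⟫ = (u ⬝ᵥ u') * (v ⬝ᵥ v') := by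
  rw [inner_vec_vecMulVec, unvec_vec, Matrix.vecMulVec_mulVec, dotProduct_comm v v']
  simp [mul_comm, dotProduct_smul]

lemma orthonormal_vec_vecMulVec {ι κ : Type*} [DecidableEq ι] [DecidableEq κ]
    {u : ι → Fin a → ℝ} {v : κ → Fin b → ℝ}
    (hu : ∀ i i', u i ⬝ᵥ u i' = if i = i' then 1 else 0)
    (hv : ∀ k k', v k ⬝ᵥ v k' = if k = k' then 1 else 0) :
    Orthonormal ℝ fun e : ι × κ => vec (Matrix.vecMulVec (u e.1) (v e.2)) := by
  rw [orthonormal_iff_ite]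
  rintro ⟨i, k⟩ ⟨i', k'⟩
  rw [inner_vec_vecMulVec_vecMulVec, hu, hv]
  by_cases h1 : i = i' <;> by_cases h2 : k = k' <;> simp [h1, h2]

/-! ### Extreme singular values of Gaussian matrices -/

section

variable {n p : ℕ}

lemma stdGaussian_real_le_mul_sum_mulVec_sq (R : Finset (Fin n)) {v : EuclideanSpace ℝ (Fin p)}
    (hv : ‖v‖ = 1) {α : ℝ} (hα : α < 1 / 2) (t : ℝ) :
    (stdGaussian (EuclideanSpace ℝ (Fin n × Fin p))).real
      {x | t ≤ α * ∑ i ∈ R, (unvec x *ᵥ v.ofLp) i ^ 2} ≤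
      Real.exp (-t - R.card / 2 * Real.log (1 - 2 * α)) := by
  have hvv : v.ofLp ⬝ᵥ v.ofLp = 1 := by
    have := EuclideanSpace.real_norm_sq_eq v
    rw [hv] at this
    rw [dotProduct]
    simpa [sq] using this.symm
  have hon : Orthonormal ℝ fun i : R =>
      vec (Matrix.vecMulVec (Pi.single (i : Fin n) (1 : ℝ)) v.ofLp) := by
    rw [orthonormal_iff_ite]
    intro i j
    rw [inner_vec_vecMulVec_vecMulVec, hvv, single_dotProduct, Pi.single_apply, mul_one, one_mul]
    simp only [Subtype.coe_inj]
  refine le_trans (le_of_eq ?_) ((stdGaussian_real_le_sum_mul_inner_sq hon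
    (a := fun _ => α) (fun _ => hα) t).trans_eq ?_)
  · congr 1
    ext x
    simp only [Set.mem_ofPred_eq, inner_vec_vecMulVec, single_dotProduct, one_mul]
    rw [← Finset.mul_sum, ← Finset.sum_coe_sort R]
  · congr 1
    simp only [Finset.sum_const, Finset.card_univ, Fintype.card_coe, nsmul_eq_mul]
    ring

/-- The action of the rows of a matrix indexed by `R` on Euclidean vectors. -/
noncomputable def rowMap (R : Finset (Fin n)) (M : Matrix (Fin n) (Fin p) ℝ) :
    EuclideanSpace ℝ (Fin p) →ₗ[ℝ] EuclideanSpace ℝ R where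
  toFun v := WithLp.toLp 2 fun i => (M *ᵥ v.ofLp) i
  map_add' v w := by
    ext i
    simp [Matrix.mulVec_add]
  map_smul' c v := by
    ext i
    simp [Matrix.mulVec_smul]

lemma norm_rowMap_sq (R : Finset (Fin n)) (M : Matrix (Fin n) (Fin p) ℝ)
    (v : EuclideanSpace ℝ (Fin p)) :
    ‖rowMap R M v‖ ^ 2 = ∑ i ∈ R, (M *ᵥ v.ofLp) i ^ 2 := by
  rw [EuclideanSpace.real_norm_sq_eq, ← Finset.sum_coe_sort R]
  rfl

lemma norm_rowMap_le (R : Finset (Fin n)) (M : Matrix (Fin n) (Fin p) ℝ)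
    (v : EuclideanSpace ℝ (Fin p)) : ‖rowMap R M v‖ ≤ ‖rowMap Finset.univ M v‖ := by
  refine le_of_sq_le_sq ?_ (norm_nonneg _)
  rw [norm_rowMap_sq, norm_rowMap_sq]
  exact Finset.sum_le_sum_of_subset_of_nonneg (Finset.subset_univ R) fun _ _ _ => sq_nonneg _

lemma measureReal_biUnion_le_card_mul {α ι : Type*} [MeasurableSpace α] (μ : Measure α)
    (N : Finset ι) (s : ι → Set α) {δ : ℝ} (h : ∀ c ∈ N, μ.real (s c) ≤ δ) :
    μ.real (⋃ c ∈ N, s c) ≤ N.card * δ := by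
  refine (measureReal_biUnion_finset_le N s).trans ?_
  rw [← nsmul_eq_mul]
  exact Finset.sum_le_card_nsmul _ _ _ h

/-- If the matrix has at least `3 n / 4` rows in `R` and aspect ratio at least two, its rows in `R`
alone determine the length of `M v` up to a constant factor, simultaneously for all `v`: the
largest singular value of `M` is at most `e ^ 2 * √n`, the smallest one of the rows in `R` at least
`e ^ (-16) * √n`. -/
lemma stdGaussian_real_not_sum_mulVec_sq_le (R : Finset (Fin n)) (hR : 3 * (n : ℝ) ≤ 4 * R.card)
    (hp : 2 * (p : ℝ) ≤ n) :
    (stdGaussian (EuclideanSpace ℝ (Fin n × Fin p))).real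
      {x | ¬ ∀ v : Fin p → ℝ, ∑ i, (unvec x *ᵥ v) i ^ 2 ≤
        Real.exp 36 * ∑ i ∈ R, (unvec x *ᵥ v) i ^ 2} ≤ 2 * Real.exp (-n) := by
  set μ := stdGaussian (EuclideanSpace ℝ (Fin n × Fin p)) with hμ
  have hn0 : (0 : ℝ) ≤ n := Nat.cast_nonneg n
  have hp0 : (0 : ℝ) ≤ p := Nat.cast_nonneg p
  have he1 : (2.7 : ℝ) < Real.exp 1 := lt_trans (by norm_num) Real.exp_one_gt_d9
  obtain ⟨N₁, hN₁, hcard₁, hcov₁⟩ := exists_sphere_net (E := EuclideanSpace ℝ (Fin p))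
    (η := 1 / 2) (by norm_num)
  obtain ⟨N₂, hN₂, hcard₂, hcov₂⟩ := exists_sphere_net (E := EuclideanSpace ℝ (Fin p))
    (Real.exp_pos (-18))
  rw [finrank_euclideanSpace_fin] at hcard₁ hcard₂
  -- `s₁ c` is the event `‖M c‖ ^ 2 ≥ e ^ 4 * n / 4`, and `s₂ c` the event that the rows in `R` give
  -- `‖M c‖ ^ 2 ≤ 4 * e ^ (-32) * n`; they are written in the form of the Chernoff bound with the
  -- multipliers `1 / 4` and `-e ^ 32 / 4`
  let s₁ : EuclideanSpace ℝ (Fin p) → Set (EuclideanSpace ℝ (Fin n × Fin p)) := fun c =>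
    {x | Real.exp 4 * n / 16 ≤ 1 / 4 * ∑ i ∈ Finset.univ, (unvec x *ᵥ c.ofLp) i ^ 2}
  let s₂ : EuclideanSpace ℝ (Fin p) → Set (EuclideanSpace ℝ (Fin n × Fin p)) := fun c =>
    {x | -(n : ℝ) ≤ (-(Real.exp 32 / 4)) * ∑ i ∈ R, (unvec x *ᵥ c.ofLp) i ^ 2}
  -- outside the exceptional events of the two nets the comparison holds
  have hsub : {x | ¬ ∀ v : Fin p → ℝ, ∑ i, (unvec x *ᵥ v) i ^ 2 ≤
      Real.exp 36 * ∑ i ∈ R, (unvec x *ᵥ v) i ^ 2} ⊆ (⋃ c ∈ N₁, s₁ c) ∪ ⋃ c ∈ N₂, s₂ c := by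
    intro x hx
    by_contra hgood
    apply hx
    simp only [Set.mem_union, Set.mem_iUnion, not_or, not_exists, s₁, s₂, Set.mem_ofPred_eq,
      not_le] at hgood
    obtain ⟨hg₁, hg₂⟩ := hgood
    have hup : ∀ v, ‖rowMap Finset.univ (unvec x) v‖ ≤ Real.exp 2 * √n * ‖v‖ := by
      have h := norm_le_of_half_net (rowMap Finset.univ (unvec x)) hcov₁
        (C := Real.exp 2 * √n / 2) (by positivity) (fun c hc => by
          refine le_of_sq_le_sq ?_ (by positivity)
          rw [norm_rowMap_sq, div_pow, mul_pow, Real.sq_sqrt hn0, ← Real.exp_nat_mul]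
          have := hg₁ c hc
          norm_num
          linarith)
      intro v
      convert h v using 2
      ring
    have hlow : ∀ v, ‖v‖ = 1 → Real.exp (-16) * √n ≤ ‖rowMap R (unvec x) v‖ := by
      intro v hv
      obtain ⟨c, hc, hvc⟩ := hcov₂ v hv
      have h1 : 2 * Real.exp (-16) * √n ≤ ‖rowMap R (unvec x) c‖ := by
        refine le_of_sq_le_sq ?_ (norm_nonneg _)
        rw [norm_rowMap_sq, mul_pow, mul_pow, Real.sq_sqrt hn0, ← Real.exp_nat_mul]
        have := hg₂ c hc
        have h32 : Real.exp 32 * Real.exp (-32) = 1 := by rw [← Real.exp_add]; norm_num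
        have h4 : 4 * Real.exp (-32) * n ≤ ∑ i ∈ R, (unvec x *ᵥ c.ofLp) i ^ 2 :=
          calc 4 * Real.exp (-32) * n
              ≤ 4 * Real.exp (-32) * (Real.exp 32 / 4 * ∑ i ∈ R, (unvec x *ᵥ c.ofLp) i ^ 2) := by
                gcongr
                linarith
            _ = (Real.exp 32 * Real.exp (-32)) * ∑ i ∈ R, (unvec x *ᵥ c.ofLp) i ^ 2 := by ring
            _ = _ := by rw [h32, one_mul]
        norm_num
        exact h4
      have h2 : ‖rowMap R (unvec x) (c - v)‖ ≤ Real.exp (-16) * √n := by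
        refine (norm_rowMap_le _ _ _).trans ((hup _).trans ?_)
        rw [norm_sub_rev]
        calc Real.exp 2 * √n * ‖v - c‖ ≤ Real.exp 2 * √n * Real.exp (-18) := by gcongr
          _ = (Real.exp 2 * Real.exp (-18)) * √n := by ring
          _ = Real.exp (-16) * √n := by rw [← Real.exp_add]; norm_num
      have h3 : ‖rowMap R (unvec x) c‖ ≤ ‖rowMap R (unvec x) v‖ + ‖rowMap R (unvec x) (c - v)‖ := by
        rw [map_sub]
        simpa using norm_add_le (rowMap R (unvec x) v)
          (rowMap R (unvec x) c - rowMap R (unvec x) v)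
      linarith
    intro v
    have hfin : ‖rowMap Finset.univ (unvec x) (WithLp.toLp 2 v)‖ ≤
        Real.exp 18 * ‖rowMap R (unvec x) (WithLp.toLp 2 v)‖ := by
      set w : EuclideanSpace ℝ (Fin p) := WithLp.toLp 2 v
      rcases eq_or_ne w 0 with hw | hw
      · simp [hw]
      have hw' : 0 < ‖w‖ := norm_pos_iff.2 hw
      have h1 := hlow (‖w‖⁻¹ • w) (by rw [norm_smul, norm_inv, norm_norm]; field_simp)
      rw [map_smul, norm_smul, norm_inv, norm_norm, inv_mul_eq_div, le_div_iff₀ hw'] at h1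
      calc _ ≤ Real.exp 2 * √n * ‖w‖ := hup w
        _ = Real.exp 18 * (Real.exp (-16) * √n * ‖w‖) := by
          have : Real.exp 2 = Real.exp 18 * Real.exp (-16) := by rw [← Real.exp_add]; norm_num
          rw [this]
          ring
        _ ≤ _ := by gcongr
    have hsq := pow_le_pow_left₀ (norm_nonneg _) hfin 2
    rw [mul_pow, norm_rowMap_sq, norm_rowMap_sq, ← Real.exp_nat_mul] at hsq
    norm_num at hsq ⊢
    exact hsq
  have hb₁ : μ.real (⋃ c ∈ N₁, s₁ c) ≤ Real.exp (-n) := by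
    refine (measureReal_biUnion_le_card_mul μ N₁ s₁ (fun c hc =>
      stdGaussian_real_le_mul_sum_mulVec_sq Finset.univ (hN₁ c hc) (by norm_num) _)).trans ?_
    have h5 : (1 + 2 / (1 / 2 : ℝ)) ^ p ≤ Real.exp n := by
      have : (1 + 2 / (1 / 2 : ℝ)) ≤ Real.exp 2 := by
        have h2 : Real.exp 2 = Real.exp 1 * Real.exp 1 := by rw [← Real.exp_add]; norm_num
        rw [h2]
        nlinarith
      refine (pow_le_pow_left₀ (by norm_num) this p).trans ?_
      rw [← Real.exp_nat_mul]
      exact Real.exp_le_exp.2 (by linarith)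
    refine (mul_le_mul_of_nonneg_right (hcard₁.trans h5) (Real.exp_pos _).le).trans ?_
    rw [← Real.exp_add]
    refine Real.exp_le_exp.2 ?_
    have hlog : Real.log (1 - 2 * (1 / 4)) = -Real.log 2 := by
      rw [← Real.log_inv]
      norm_num
    have h4 : (48 : ℝ) ≤ Real.exp 4 := by
      have h2 : Real.exp 4 = (Real.exp 1 * Real.exp 1) * (Real.exp 1 * Real.exp 1) := by
        simp only [← Real.exp_add]; norm_num
      have h3 : (7.29 : ℝ) ≤ Real.exp 1 * Real.exp 1 := by nlinarith
      rw [h2]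
      nlinarith
    rw [hlog, Finset.card_univ, Fintype.card_fin]
    nlinarith [mul_le_mul_of_nonneg_right h4 hn0,
      mul_le_mul_of_nonneg_right Real.log_two_lt_d9.le hn0]
  have hb₂ : μ.real (⋃ c ∈ N₂, s₂ c) ≤ Real.exp (-n) := by
    have hneg : -(Real.exp 32 / 4) < 1 / 2 := by linarith [Real.exp_pos 32]
    refine (measureReal_biUnion_le_card_mul μ N₂ s₂ (fun c hc =>
      stdGaussian_real_le_mul_sum_mulVec_sq R (hN₂ c hc) hneg _)).trans ?_
    have h5 : (1 + 2 / Real.exp (-18)) ^ p ≤ Real.exp (19 * n / 2) := by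
      have : (1 + 2 / Real.exp (-18)) ≤ Real.exp 19 := by
        have h2 : Real.exp 19 = Real.exp 1 * Real.exp 18 := by rw [← Real.exp_add]; norm_num
        have h18 : (18 : ℝ) + 1 ≤ Real.exp 18 := Real.add_one_le_exp 18
        rw [h2, Real.exp_neg, div_inv_eq_mul]
        nlinarith
      refine (pow_le_pow_left₀ (by positivity) this p).trans ?_
      rw [← Real.exp_nat_mul]
      exact Real.exp_le_exp.2 (by linarith)
    refine (mul_le_mul_of_nonneg_right (hcard₂.trans h5) (Real.exp_pos _).le).trans ?_
    rw [← Real.exp_add]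
    refine Real.exp_le_exp.2 ?_
    have hlog : 31 ≤ Real.log (1 - 2 * (-(Real.exp 32 / 4))) := by
      rw [Real.le_log_iff_exp_le (by linarith [Real.exp_pos 32])]
      have h2 : Real.exp 32 = Real.exp 1 * Real.exp 31 := by rw [← Real.exp_add]; norm_num
      rw [h2]
      nlinarith [Real.exp_pos 31]
    have hR' : 3 * (n : ℝ) / 8 ≤ R.card / 2 := by linarith
    have := mul_le_mul hR' hlog (by norm_num) (by positivity)
    linarith
  calc _ ≤ μ.real ((⋃ c ∈ N₁, s₁ c) ∪ ⋃ c ∈ N₂, s₂ c) := measureReal_mono hsub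
    _ ≤ μ.real (⋃ c ∈ N₁, s₁ c) + μ.real (⋃ c ∈ N₂, s₂ c) := measureReal_union_le _ _
    _ ≤ 2 * Real.exp (-n) := by linarith

end

/-! ### The singular value decomposition of the signal -/

open scoped Matrix.Norms.L2Operator in
/-- The spectral decomposition of `B * Bᵀ`, which provides the left singular vectors `u` and the
squared singular values `l` of `B`. -/
lemma exists_left_singular_system {p m : ℕ} (B : Matrix (Fin p) (Fin m) ℝ) :
    ∃ (u : Fin p → Fin p → ℝ) (l : Fin p → ℝ),
      (∀ k k', u k ⬝ᵥ u k' = if k = k' then 1 else 0) ∧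
      (∀ k, 0 ≤ l k ∧ l k ≤ opNorm B ^ 2) ∧ ∑ k, l k = frobSq B ∧
      (Finset.univ.filter fun k => l k ≠ 0).card = B.rank ∧
      ∀ y : Fin p → ℝ, ∑ j, (y ᵥ* B) j ^ 2 = ∑ k, l k * (u k ⬝ᵥ y) ^ 2 := by
  have hA : (B * Bᵀ).IsHermitian := by
    rw [← Matrix.conjTranspose_eq_transpose_of_trivial]
    exact Matrix.isHermitian_mul_conjTranspose_self B
  have hsq : ∀ y : Fin p → ℝ, ∑ j, (y ᵥ* B) j ^ 2 = y ⬝ᵥ ((B * Bᵀ) *ᵥ y) := by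
    intro y
    rw [← Matrix.mulVec_mulVec, Matrix.mulVec_transpose, Matrix.dotProduct_mulVec, dotProduct]
    simp [sq]
  have hinner : ∀ v w : EuclideanSpace ℝ (Fin p), ⟪v, w⟫ = v.ofLp ⬝ᵥ w.ofLp := by
    intro v w
    rw [PiLp.inner_apply, dotProduct]
    simp [mul_comm]
  have heig : ∀ k, (B * Bᵀ) *ᵥ (hA.eigenvectorBasis k).ofLp
      = hA.eigenvalues k • (hA.eigenvectorBasis k).ofLp := hA.mulVec_eigenvectorBasis
  have hon : ∀ k k', (hA.eigenvectorBasis k).ofLp ⬝ᵥ (hA.eigenvectorBasis k').ofLp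
      = if k = k' then 1 else 0 := by
    intro k k'
    rw [← hinner]
    exact orthonormal_iff_ite.1 hA.eigenvectorBasis.orthonormal k k'
  have hval : ∀ k, hA.eigenvalues k = ∑ j, ((hA.eigenvectorBasis k).ofLp ᵥ* B) j ^ 2 := by
    intro k
    rw [hsq, heig, dotProduct_smul, hon]
    simp
  refine ⟨fun k => (hA.eigenvectorBasis k).ofLp, hA.eigenvalues, hon, fun k => ⟨?_, ?_⟩, ?_, ?_, ?_⟩
  · rw [hval]
    positivity
  · have h1 := Matrix.l2_opNorm_mulVec Bᵀ (hA.eigenvectorBasis k)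
    rw [hA.eigenvectorBasis.orthonormal.1 k, mul_one] at h1
    have h2 := pow_le_pow_left₀ (norm_nonneg _) h1 2
    rw [EuclideanSpace.real_norm_sq_eq] at h2
    rw [hval, opNorm]
    have h3 : ‖Bᵀ‖ = ‖B‖ := by
      rw [← Matrix.conjTranspose_eq_transpose_of_trivial, Matrix.l2_opNorm_conjTranspose]
    rw [h3] at h2
    simpa [Matrix.mulVec_transpose] using h2
  · have h1 := hA.trace_eq_sum_eigenvalues
    rw [Matrix.trace] at h1
    simp only [RCLike.ofReal_real_eq_id, id_eq] at h1
    rw [← h1, frobSq]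
    simp [Matrix.mul_apply, sq]
  · rw [← Matrix.rank_self_mul_transpose, hA.rank_eq_card_non_zero_eigs, Fintype.card_subtype]
  · intro y
    rw [hsq]
    have h1 := hA.eigenvectorBasis.sum_inner_mul_inner (WithLp.toLp 2 y)
      (WithLp.toLp 2 ((B * Bᵀ) *ᵥ y))
    simp only [hinner] at h1
    rw [← h1]
    refine Finset.sum_congr rfl fun k _ => ?_
    have h2 : (hA.eigenvectorBasis k).ofLp ⬝ᵥ ((B * Bᵀ) *ᵥ y)
        = hA.eigenvalues k * ((hA.eigenvectorBasis k).ofLp ⬝ᵥ y) := by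
      rw [Matrix.dotProduct_mulVec, ← Matrix.mulVec_transpose]
      have h3 : (B * Bᵀ)ᵀ = B * Bᵀ := by simp
      rw [h3, heig, smul_dotProduct, smul_eq_mul]
    rw [h2, dotProduct_comm y]
    ring

open scoped Matrix.Norms.L2Operator in
lemma opNorm_nonneg {p m : ℕ} (B : Matrix (Fin p) (Fin m) ℝ) : 0 ≤ opNorm B := norm_nonneg B

lemma stableRank_le_rank {p m : ℕ} (B : Matrix (Fin p) (Fin m) ℝ) : stableRank B ≤ B.rank := by
  obtain ⟨u, l, -, hl, hsum, hrank, -⟩ := exists_left_singular_system B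
  refine div_le_of_le_mul₀ (sq_nonneg _) (Nat.cast_nonneg _) ?_
  rw [← hsum, ← Finset.sum_filter_ne_zero, ← hrank, ← nsmul_eq_mul]
  exact Finset.sum_le_card_nsmul _ _ _ fun k _ => (hl k).2

/-! ### Displacement of the signal by a permutation -/

/-- A third of the points moved by a permutation can be chosen so that their images are not
chosen. -/
lemma exists_disjoint_image {α : Type*} [Fintype α] [DecidableEq α] (τ : Equiv.Perm α) :
    ∃ I : Finset α, (Finset.univ.filter fun i => τ i ≠ i).card ≤ 3 * I.card ∧
      ∀ i ∈ I, ∀ j ∈ I, τ i ≠ j := by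
  obtain ⟨I, hI, hmax⟩ := Finset.exists_max_image
    (Finset.univ.filter fun I : Finset α => ∀ i ∈ I, ∀ j ∈ I, τ i ≠ j) Finset.card ⟨∅, by simp⟩
  simp only [Finset.mem_filter, Finset.mem_univ, true_and] at hI hmax
  refine ⟨I, ?_, hI⟩
  have hsub : (Finset.univ.filter fun i => τ i ≠ i) ⊆ (I ∪ I.image τ) ∪ I.image τ.symm := by
    intro i hi
    simp only [Finset.mem_filter, Finset.mem_univ, true_and] at hi
    by_contra hnot
    simp only [Finset.mem_union, Finset.mem_image, not_or, not_exists, not_and] at hnot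
    obtain ⟨⟨h1, h2⟩, h3⟩ := hnot
    have := hmax (insert i I) (by
      intro a ha b hb
      rcases Finset.mem_insert.1 ha with ha' | ha' <;> rcases Finset.mem_insert.1 hb with hb' | hb'
      · rw [ha', hb']
        exact hi
      · rw [ha']
        intro h
        exact h3 b hb' (by rw [← h, Equiv.symm_apply_apply])
      · rw [hb']
        exact h2 a ha'
      · exact hI a ha' b hb')
    rw [Finset.card_insert_of_notMem h1] at this
    omega
  have h1 := Finset.card_le_card hsub
  have h2 := Finset.card_union_le (I ∪ I.image τ) (I.image τ.symm)
  have h3 := Finset.card_union_le I (I.image τ)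
  have h4 := Finset.card_image_le (s := I) (f := τ)
  have h5 := Finset.card_image_le (s := I) (f := τ.symm)
  omega

/-- Permuting the rows of the signal matrix `X * B` displaces it by a constant fraction of its
expected size: the displacements of the rows in the set of `exists_disjoint_image` are
independent. -/
lemma stdGaussian_real_not_le_frobSq_sub {n p m : ℕ} (τ : Equiv.Perm (Fin n))
    (B : Matrix (Fin p) (Fin m) ℝ) (hB : 0 < opNorm B) :
    (stdGaussian (EuclideanSpace ℝ (Fin n × Fin p))).real
      {x | ¬ ((Finset.univ.filter fun i => τ i ≠ i).card : ℝ) / 6 * frobSq B ≤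
        frobSq (unvec x * B - (unvec x).submatrix τ id * B)} ≤
      Real.exp (-((Finset.univ.filter fun i => τ i ≠ i).card * stableRank B / 24)) := by
  obtain ⟨u, l, hu, hl, hsum, -, hquad⟩ := exists_left_singular_system B
  obtain ⟨I, hcard, hI⟩ := exists_disjoint_image τ
  set d := (Finset.univ.filter fun i => τ i ≠ i).card with hd
  have hcard' : (d : ℝ) ≤ 3 * I.card := mod_cast hcard
  have hfrob0 : 0 ≤ frobSq B := by rw [frobSq]; positivity
  have hρ0 : 0 ≤ stableRank B := div_nonneg hfrob0 (sq_nonneg _)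
  have hsum' : ∑ k, l k / opNorm B ^ 2 = stableRank B := by
    rw [← Finset.sum_div, hsum, stableRank]
  -- normalized difference functionals; they are orthonormal because the pairs `{i, τ i}`, `i ∈ I`,
  -- are disjoint
  let w : I → Fin n → ℝ := fun i => (√2)⁻¹ • (Pi.single (i : Fin n) (1 : ℝ) - Pi.single (τ i) 1)
  have hw2 : (√2)⁻¹ * (√2)⁻¹ = (1 / 2 : ℝ) := by
    rw [← mul_inv, Real.mul_self_sqrt (by norm_num)]
    norm_num
  have hw : ∀ i i', w i ⬝ᵥ w i' = if i = i' then 1 else 0 := by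
    intro i i'
    have h1 : (i : Fin n) ≠ τ i' := (hI i' i'.2 i i.2).symm
    have h2 : τ (i : Fin n) ≠ i' := hI i i.2 i' i'.2
    simp only [w, smul_dotProduct, dotProduct_smul, smul_eq_mul]
    rw [← mul_assoc, hw2, sub_dotProduct, single_dotProduct, single_dotProduct]
    simp only [Pi.sub_apply, Pi.single_apply, one_mul, h1, h2, if_false, sub_zero, zero_sub,
      τ.injective.eq_iff, Subtype.coe_inj]
    split_ifs <;> norm_num
  have hon := orthonormal_vec_vecMulVec hw hu
  have hinner : ∀ (x : EuclideanSpace ℝ (Fin n × Fin p)) (i : I) (k : Fin p),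
      ⟪vec (Matrix.vecMulVec (w i) (u k)), x⟫ ^ 2
        = 1 / 2 * (u k ⬝ᵥ (unvec x i - unvec x (τ i))) ^ 2 := by
    intro x i k
    rw [inner_vec_vecMulVec]
    simp only [w]
    rw [smul_dotProduct, sub_dotProduct, single_dotProduct, single_dotProduct, smul_eq_mul, mul_pow,
      sq (√2)⁻¹, hw2, dotProduct_sub, dotProduct_comm (u k), dotProduct_comm (u k)]
    simp only [Matrix.mulVec, one_mul]
  have hrows : ∀ x : EuclideanSpace ℝ (Fin n × Fin p),
      ∑ i : I, ∑ k, l k * (u k ⬝ᵥ (unvec x i - unvec x (τ i))) ^ 2 ≤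
        frobSq (unvec x * B - (unvec x).submatrix τ id * B) := by
    intro x
    simp_rw [← hquad]
    rw [Finset.sum_coe_sort I fun i => ∑ j, ((unvec x i - unvec x (τ i)) ᵥ* B) j ^ 2, frobSq]
    refine (Finset.sum_le_sum_of_subset_of_nonneg (Finset.subset_univ I)
      fun _ _ _ => by positivity).trans (le_of_eq ?_)
    refine Finset.sum_congr rfl fun i _ => Finset.sum_congr rfl fun j _ => ?_
    rw [Matrix.sub_vecMul]
    rfl
  -- the coefficients are `-t / 2` with `t = l k / ‖B‖ ^ 2` in `[0, 1]`, where `log (1 + t) ≥ t / 2`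
  have htail := stdGaussian_real_le_sum_mul_inner_sq hon
    (a := fun e => -(l e.2 / (2 * opNorm B ^ 2)))
    (fun e => by
      have : 0 ≤ l e.2 / (2 * opNorm B ^ 2) := div_nonneg (hl _).1 (by positivity)
      linarith) (-(I.card * stableRank B / 8))
  refine (measureReal_mono ?_).trans (htail.trans (Real.exp_le_exp.2 ?_))
  · intro x hx
    simp only [Set.mem_ofPred_eq, not_le] at hx ⊢
    have h1 : ∑ e : I × Fin p, -(l e.2 / (2 * opNorm B ^ 2)) *
          ⟪vec (Matrix.vecMulVec (w e.1) (u e.2)), x⟫ ^ 2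
        = -(∑ i : I, ∑ k, l k * (u k ⬝ᵥ (unvec x i - unvec x (τ i))) ^ 2)
          / (4 * opNorm B ^ 2) := by
      rw [Fintype.sum_prod_type, neg_div, Finset.sum_div, ← Finset.sum_neg_distrib]
      refine Finset.sum_congr rfl fun i _ => ?_
      rw [Finset.sum_div, ← Finset.sum_neg_distrib]
      refine Finset.sum_congr rfl fun k _ => ?_
      rw [hinner]
      field_simp
      ring
    rw [h1, neg_div, neg_le_neg_iff, div_le_iff₀ (by positivity), stableRank]
    have h2 := (hrows x).trans hx.le
    have h3 : (d : ℝ) / 6 * frobSq B ≤ I.card / 2 * frobSq B :=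
      mul_le_mul_of_nonneg_right (by linarith) hfrob0
    refine (h2.trans h3).trans (le_of_eq ?_)
    field_simp
    ring
  · have h1 : I.card * (stableRank B / 2) ≤
        ∑ e : I × Fin p, Real.log (1 - 2 * -(l e.2 / (2 * opNorm B ^ 2))) := by
      rw [Fintype.sum_prod_type]
      simp only [Finset.sum_const, Finset.card_univ, Fintype.card_coe, nsmul_eq_mul]
      gcongr
      rw [← hsum', Finset.sum_div]
      refine Finset.sum_le_sum fun k _ => ?_
      have h0 : 0 ≤ l k / opNorm B ^ 2 := div_nonneg (hl k).1 (by positivity)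
      have h1 : l k / opNorm B ^ 2 ≤ 1 := (div_le_one (by positivity)).2 (hl k).2
      have h2 : 1 - 2 * -(l k / (2 * opNorm B ^ 2)) = 1 + l k / opNorm B ^ 2 := by
        field_simp
        ring
      rw [h2]
      refine le_trans ?_ (Real.le_log_one_add_of_nonneg h0)
      rw [div_le_div_iff₀ (by norm_num) (by linarith)]
      nlinarith
    have h2 := mul_le_mul_of_nonneg_right hcard' hρ0
    linarith

/-! ### Gaussian noise and the distances to two subspaces -/

section

variable {F : Type*} [NormedAddCommGroup F] [InnerProductSpace ℝ F] [FiniteDimensional ℝ F]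

lemma infDist_submodule (U : Submodule ℝ F) (y : F) :
    Metric.infDist y U = ‖y - U.starProjection y‖ := by
  rw [U.starProjection_minimal, Metric.infDist_eq_iInf]
  simp [dist_eq_norm]

lemma norm_sub_starProjection_sq (U : Submodule ℝ F) (y : F) :
    ‖y - U.starProjection y‖ ^ 2 = ‖y‖ ^ 2 - ‖U.starProjection y‖ ^ 2 := by
  have h1 : ⟪U.starProjection y, y - U.starProjection y⟫ = 0 := by
    rw [real_inner_comm]
    exact U.starProjection_inner_eq_zero y _ (U.starProjection_apply_mem y)
  have h2 := norm_add_sq_real (U.starProjection y) (y - U.starProjection y)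
  rw [add_sub_cancel, h1] at h2
  linarith

/-- Only the part of `U` orthogonal to a common subspace `L` of `U` and `U₀` can make the projection
onto `U` longer than the projection onto `U₀`. -/
lemma norm_starProjection_sq_le {U U₀ L : Submodule ℝ F} (hLU : L ≤ U) (hLU₀ : L ≤ U₀)
    {ι : Type*} [Fintype ι] (b : OrthonormalBasis ι ℝ ↥(U ⊓ Lᗮ)) (z : F) :
    ‖U.starProjection z‖ ^ 2 - ‖U₀.starProjection z‖ ^ 2 ≤ ∑ i, ⟪(b i : F), z⟫ ^ 2 := by
  set q := U.starProjection z
  set r := L.starProjection z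
  have hrL : r ∈ L := L.starProjection_apply_mem z
  have hzq : ∀ u ∈ U, ⟪u, q⟫ = ⟪u, z⟫ := by
    intro u hu
    have h := U.starProjection_inner_eq_zero z u hu
    rw [real_inner_comm, inner_sub_right] at h
    linarith
  have hzr : ∀ u ∈ L, ⟪u, r⟫ = ⟪u, z⟫ := by
    intro u hu
    have h := L.starProjection_inner_eq_zero z u hu
    rw [real_inner_comm, inner_sub_right] at h
    linarith
  have hV : q - r ∈ U ⊓ Lᗮ := by
    refine ⟨U.sub_mem (U.starProjection_apply_mem z) (hLU hrL),
      (Submodule.mem_orthogonal _ _).2 fun u hu => ?_⟩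
    rw [inner_sub_right, hzq u (hLU hu), hzr u hu, sub_self]
  have hnorm : ‖q‖ ^ 2 = ‖r‖ ^ 2 + ‖q - r‖ ^ 2 := by
    have h := norm_add_sq_real r (q - r)
    rw [add_sub_cancel, (Submodule.mem_orthogonal _ _).1 hV.2 r hrL] at h
    linarith
  have hr : ‖r‖ ^ 2 ≤ ‖U₀.starProjection z‖ ^ 2 := by
    have h1 : r = L.starProjection (U₀.starProjection z) := by
      refine (Submodule.eq_starProjection_of_mem_of_inner_eq_zero hrL fun u hu => ?_).symm
      have h := U₀.starProjection_inner_eq_zero z u (hLU₀ hu)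
      have h2 := hzr u hu
      rw [real_inner_comm, inner_sub_right] at h ⊢
      linarith
    rw [h1]
    exact pow_le_pow_left₀ (norm_nonneg _) (Submodule.norm_starProjection_apply_le _ _) 2
  have hsum : ‖q - r‖ ^ 2 = ∑ i, ⟪(b i : F), z⟫ ^ 2 := by
    have h := b.sum_sq_inner_right ⟨q - r, hV⟩
    rw [Submodule.coe_norm] at h
    rw [← h]
    refine Finset.sum_congr rfl fun i _ => ?_
    have hb : (b i : F) ∈ U ⊓ Lᗮ := (b i).2
    rw [Submodule.coe_inner, inner_sub_right, hzq _ hb.1,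
      Submodule.inner_left_of_mem_orthogonal hrL hb.2, sub_zero]
  linarith

variable [MeasurableSpace F] [BorelSpace F]

/-- Let the signal `θ` lie in `U₀` and have distance `‖θ - P θ‖` from `U`. Gaussian noise makes the
observation at least as close to `U` as to `U₀` only if it is large in the direction of `θ - P θ` or
along the part of `U` orthogonal to `U ⊓ U₀`. -/
lemma stdGaussian_real_infDist_le (U U₀ : Submodule ℝ F) {θ : F} (hθ : θ ∈ U₀) {σ : ℝ} (hσ : 0 < σ)
    {k : ℕ} (hk : Module.finrank ℝ U ≤ Module.finrank ℝ ↥(U ⊓ U₀) + k)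
    (hT : 0 < ‖θ - U.starProjection θ‖) :
    (stdGaussian F).real
      {z | Metric.infDist (θ + σ • z) U ≤ Metric.infDist (θ + σ • z) U₀} ≤
      Real.exp (Real.log 2 / 2 - ‖θ - U.starProjection θ‖ ^ 2 / (64 * σ ^ 2)) +
      Real.exp (k * Real.log 2 / 2 - ‖θ - U.starProjection θ‖ ^ 2 / (8 * σ ^ 2)) := by
  set T := θ - U.starProjection θ with hTdef
  set V := U ⊓ (U ⊓ U₀)ᗮ with hV
  have hVk : Module.finrank ℝ V ≤ k := by
    have h := Submodule.finrank_add_inf_finrank_orthogonal (inf_le_left : U ⊓ U₀ ≤ U)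
    have h' : Module.finrank ℝ V = Module.finrank ℝ ↥((U ⊓ U₀)ᗮ ⊓ U) := by rw [hV, inf_comm]
    omega
  have hlog : Real.log (1 - 2 * (1 / 4)) = -Real.log 2 := by
    rw [← Real.log_inv]
    norm_num
  have hlog2 : 0 < Real.log 2 := Real.log_pos (by norm_num)
  let b := stdOrthonormalBasis ℝ V
  have hb : Orthonormal ℝ fun i => (b i : F) :=
    b.orthonormal.comp_linearIsometry V.subtypeₗᵢ
  have hu : Orthonormal ℝ fun _ : Unit => ‖T‖⁻¹ • T := by
    refine ⟨fun _ => ?_, fun i j hij => absurd rfl hij⟩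
    rw [norm_smul, norm_inv, norm_norm, inv_mul_cancel₀ hT.ne']
  have h₁ := stdGaussian_real_le_sum_mul_inner_sq hu (a := fun _ => 1 / 4) (fun _ => by norm_num)
    (‖T‖ ^ 2 / (64 * σ ^ 2))
  have h₂ := stdGaussian_real_le_sum_mul_inner_sq hb (a := fun _ => 1 / 4) (fun _ => by norm_num)
    (‖T‖ ^ 2 / (8 * σ ^ 2))
  refine (measureReal_mono ?_).trans ((measureReal_union_le _ _).trans
    (add_le_add (h₁.trans (Real.exp_le_exp.2 ?_)) (h₂.trans (Real.exp_le_exp.2 ?_))))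
  · intro z hz
    rw [Set.mem_ofPred_eq, infDist_submodule, infDist_submodule] at hz
    have hz2 := pow_le_pow_left₀ (norm_nonneg _) hz 2
    have hU₀ : θ + σ • z - U₀.starProjection (θ + σ • z)
        = σ • (z - U₀.starProjection z) := by
      rw [map_add, map_smul, Submodule.starProjection_eq_self_iff.2 hθ, smul_sub]
      abel
    have hU : θ + σ • z - U.starProjection (θ + σ • z)
        = T + σ • (z - U.starProjection z) := by
      rw [map_add, map_smul, smul_sub, hTdef]
      abel
    have hTz : ⟪T, z - U.starProjection z⟫ = ⟪T, z⟫ := by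
      rw [inner_sub_right, U.starProjection_inner_eq_zero θ _ (U.starProjection_apply_mem z),
        sub_zero]
    rw [hU₀, hU, norm_add_sq_real, norm_smul, norm_smul, mul_pow, mul_pow,
      norm_sub_starProjection_sq U z, norm_sub_starProjection_sq U₀ z, inner_smul_right, hTz,
      Real.norm_eq_abs, sq_abs] at hz2
    have hproj := norm_starProjection_sq_le inf_le_left inf_le_right b z
    have hmain : ‖T‖ ^ 2 + 2 * (σ * ⟪T, z⟫) ≤ σ ^ 2 * ∑ i, ⟪(b i : F), z⟫ ^ 2 := by
      nlinarith [mul_le_mul_of_nonneg_left hproj (sq_nonneg σ)]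
    simp only [Set.mem_union, Set.mem_ofPred_eq, Finset.univ_unique, Finset.sum_singleton]
    rcases le_or_gt (‖T‖ ^ 2 / 2) (σ ^ 2 * ∑ i, ⟪(b i : F), z⟫ ^ 2) with hcase | hcase
    · right
      rw [← Finset.mul_sum, div_le_iff₀ (by positivity)]
      linarith
    · left
      have h1 : ‖T‖ ^ 2 / 4 ≤ -(σ * ⟪T, z⟫) := by linarith
      have h2 := pow_le_pow_left₀ (by positivity) h1 2
      rw [real_inner_smul_left, div_le_iff₀ (by positivity), mul_pow, inv_pow]
      have h3 : 0 < ‖T‖ ^ 2 := by positivity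
      have h4 : 1 / 4 * ((‖T‖ ^ 2)⁻¹ * ⟪T, z⟫ ^ 2) * (64 * σ ^ 2)
          = 16 * (σ * ⟪T, z⟫) ^ 2 / ‖T‖ ^ 2 := by
        field_simp
        ring
      rw [h4, le_div_iff₀ h3]
      linarith
  · simp only [Finset.univ_unique, Finset.sum_singleton]
    rw [hlog]
    linarith
  · simp only [Finset.sum_const, Finset.card_univ, Fintype.card_fin, nsmul_eq_mul]
    rw [hlog]
    have : (Module.finrank ℝ V : ℝ) ≤ k := mod_cast hVk
    nlinarith

end

/-- The ranges of two linear maps differ by at most the rank of their difference. -/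
lemma finrank_range_le_inf_add {M F : Type*} [AddCommGroup M] [Module ℝ M] [FiniteDimensional ℝ M]
    [AddCommGroup F] [Module ℝ F] [FiniteDimensional ℝ F] (f g : M →ₗ[ℝ] F) :
    Module.finrank ℝ (LinearMap.range f) ≤
      Module.finrank ℝ ↥(LinearMap.range f ⊓ LinearMap.range g) +
        Module.finrank ℝ (LinearMap.range (f - g)) := by
  set K := LinearMap.ker (f - g)
  have hK : K.map f ≤ LinearMap.range f ⊓ LinearMap.range g := by
    rintro _ ⟨x, hx, rfl⟩
    refine ⟨⟨x, rfl⟩, ⟨x, ?_⟩⟩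
    have : f x - g x = 0 := hx
    exact (sub_eq_zero.1 this).symm
  have h1 := Submodule.finrank_mono hK
  have h2 := LinearMap.finrank_range_add_finrank_ker f
  have h3 := LinearMap.finrank_range_add_finrank_ker (f - g)
  have h4 := LinearMap.finrank_range_add_finrank_ker (f.domRestrict K)
  have h5 : LinearMap.range (f.domRestrict K) = K.map f := by
    rw [LinearMap.domRestrict, LinearMap.range_comp, Submodule.range_subtype]
  have h6 : Module.finrank ℝ (LinearMap.ker (f.domRestrict K)) ≤
      Module.finrank ℝ (LinearMap.ker f) := by
    refine LinearMap.finrank_le_finrank_of_injective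
      (f := K.subtype.restrict (p := LinearMap.ker (f.domRestrict K)) (q := LinearMap.ker f)
        fun x hx => hx) ?_
    intro x y hxy
    have h := congrArg Subtype.val hxy
    exact Subtype.ext (Subtype.ext h)
  rw [h5] at h4
  change Module.finrank ℝ (LinearMap.range (f - g)) + Module.finrank ℝ K = _ at h3
  omega

/-! ### The least squares residual -/

section

variable {n p m : ℕ}

/-- The map sending a coefficient matrix `B` to the fitted values `M * B`, as a Euclidean vector. -/
noncomputable def fitMap (m : ℕ) (M : Matrix (Fin n) (Fin p) ℝ) :
    Matrix (Fin p) (Fin m) ℝ →ₗ[ℝ] EuclideanSpace ℝ (Fin n × Fin m) where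
  toFun B := vec (M * B)
  map_add' B B' := by
    ext e
    simp [Matrix.mul_add]
  map_smul' c B := by
    ext e
    simp

/-- The least squares residual of `y` under the design `M`: its Euclidean distance from the space of
fitted values. -/
noncomputable def resid (M : Matrix (Fin n) (Fin p) ℝ) (y : EuclideanSpace ℝ (Fin n × Fin m)) : ℝ :=
  Metric.infDist y (LinearMap.range (fitMap m M))

lemma resid_le (M : Matrix (Fin n) (Fin p) ℝ) (y : EuclideanSpace ℝ (Fin n × Fin m))
    (B : Matrix (Fin p) (Fin m) ℝ) : resid M y ≤ ‖y - vec (M * B)‖ := by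
  rw [← dist_eq_norm]
  exact Metric.infDist_le_dist_of_mem ⟨B, rfl⟩

lemma exists_norm_sub_eq_resid (M : Matrix (Fin n) (Fin p) ℝ)
    (y : EuclideanSpace ℝ (Fin n × Fin m)) :
    ∃ B : Matrix (Fin p) (Fin m) ℝ, ‖y - vec (M * B)‖ = resid M y := by
  obtain ⟨B, hB⟩ := (LinearMap.range (fitMap m M)).starProjection_apply_mem y
  refine ⟨B, ?_⟩
  rw [resid, infDist_submodule, ← hB]
  rfl

/-- The distance to a moving subspace is an infimum of continuous functions. -/
lemma measurable_resid {α : Type*} [TopologicalSpace α] [MeasurableSpace α] [OpensMeasurableSpace α]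
    {M : α → Matrix (Fin n) (Fin p) ℝ} (hM : Continuous M)
    {y : α → EuclideanSpace ℝ (Fin n × Fin m)} (hy : Continuous y) :
    Measurable fun t => resid (M t) (y t) := by
  refine measurable_of_Iio fun r => IsOpen.measurableSet ?_
  have h : (fun t => resid (M t) (y t)) ⁻¹' Set.Iio r
      = ⋃ B : Matrix (Fin p) (Fin m) ℝ, {t | dist (y t) (vec (M t * B)) < r} := by
    ext t
    simp only [Set.mem_preimage, Set.mem_Iio, resid, Set.mem_iUnion, Set.mem_ofPred_eq]
    rw [Metric.infDist_lt_iff ⟨0, Submodule.zero_mem _⟩]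
    constructor
    · rintro ⟨_, ⟨B, rfl⟩, hB⟩
      exact ⟨B, hB⟩
    · rintro ⟨B, hB⟩
      exact ⟨_, ⟨B, rfl⟩, hB⟩
  rw [h]
  refine isOpen_iUnion fun B => isOpen_lt (hy.dist ?_) continuous_const
  have hMB : Continuous fun t => M t * B := hM.matrix_mul continuous_const
  exact (PiLp.continuous_toLp 2 _).comp (continuous_pi fun e => hMB.matrix_elem e.1 e.2)

lemma permMatrix_mul_eq_submatrix (π : Equiv.Perm (Fin n)) (X : Matrix (Fin n) (Fin p) ℝ) :
    π.permMatrix ℝ * X = X.submatrix π id :=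
  PEquiv.toMatrix_toPEquiv_mul π X

/-- The restricted maximum likelihood estimator is the unique minimizer of the residual over the
Hamming ball. -/
lemma restrictedMLPerms_eq_singleton {h : ℕ} {X : Matrix (Fin n) (Fin p) ℝ}
    {Y : Matrix (Fin n) (Fin m) ℝ} {π₀ : Equiv.Perm (Fin n)} (hπ₀ : π₀ ∈ hammingBall n h)
    (hlt : ∀ π ∈ hammingBall n h, π ≠ π₀ →
      resid (X.submatrix π₀ id) (vec Y) < resid (X.submatrix π id) (vec Y)) :
    restrictedMLPerms h X Y = {π₀} := by
  have hsq : ∀ (π : Equiv.Perm (Fin n)) (B : Matrix (Fin p) (Fin m) ℝ),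
      frobSq (Y - π.permMatrix ℝ * X * B) = ‖vec Y - vec (X.submatrix π id * B)‖ ^ 2 := by
    intro π B
    rw [permMatrix_mul_eq_submatrix, ← norm_vec_sq]
    rfl
  obtain ⟨B₀, hB₀⟩ := exists_norm_sub_eq_resid (X.submatrix π₀ id) (vec Y)
  ext π
  simp only [restrictedMLPerms, Set.mem_ofPred_eq, Set.mem_singleton_iff]
  constructor
  · rintro ⟨B, hπ, hmin⟩
    by_contra hne
    have h1 := hmin π₀ hπ₀ B₀
    rw [hsq, hsq, hB₀] at h1
    have h2 := le_of_sq_le_sq h1 Metric.infDist_nonneg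
    exact absurd ((hlt π hπ hne).trans_le (resid_le _ _ B)) (not_lt.2 h2)
  · rintro rfl
    refine ⟨B₀, hπ₀, fun π' hπ' B' => ?_⟩
    rw [hsq, hsq, hB₀]
    refine pow_le_pow_left₀ Metric.infDist_nonneg ?_ 2
    rcases eq_or_ne π' π with rfl | hne
    · exact resid_le _ _ _
    · exact (hlt π' hπ' hne).le.trans (resid_le _ _ _)

lemma finrank_range_fitMap_sub_le (M : Matrix (Fin n) (Fin p) ℝ) (τ : Equiv.Perm (Fin n)) :
    Module.finrank ℝ (LinearMap.range (fitMap m (M.submatrix τ id) - fitMap m M)) ≤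
      (Finset.univ.filter fun i => τ i ≠ i).card * m := by
  let S := {i // i ∈ Finset.univ.filter fun i => τ i ≠ i}
  let f : LinearMap.range (fitMap m (M.submatrix τ id) - fitMap m M) →ₗ[ℝ] (S × Fin m → ℝ) :=
    { toFun := fun y e => (y : EuclideanSpace ℝ (Fin n × Fin m)) (e.1, e.2)
      map_add' := fun _ _ => rfl
      map_smul' := fun _ _ => rfl }
  have hf : Function.Injective f := by
    refine (injective_iff_map_eq_zero f).2 ?_
    rintro ⟨_, B, rfl⟩ h0
    ext ⟨i, j⟩
    by_cases hi : τ i = i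
    · simp [fitMap, Matrix.mul_apply, hi]
    · exact congrFun h0 (⟨i, by simpa using hi⟩, j)
  refine (LinearMap.finrank_le_finrank_of_injective hf).trans (le_of_eq ?_)
  rw [Module.finrank_fintype_fun_eq_card, Fintype.card_prod, Fintype.card_coe, Fintype.card_fin]

/-- Fitting `M * B` with the permuted design leaves a residual comparable to the displacement
`M * B - Π * M * B`: any change of `B` that reduces the misfit on the moved rows is visible on the
fixed rows. -/
lemma frobSq_sub_le_mul_frobSq {M : Matrix (Fin n) (Fin p) ℝ} {τ : Equiv.Perm (Fin n)} {K : ℝ}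
    (hK : 0 ≤ K) (hM : ∀ v : Fin p → ℝ, ∑ i, (M *ᵥ v) i ^ 2 ≤
      K * ∑ i ∈ Finset.univ.filter fun i => τ i = i, (M *ᵥ v) i ^ 2)
    (B B' : Matrix (Fin p) (Fin m) ℝ) :
    frobSq (M * B - M.submatrix τ id * B) ≤
      2 * (1 + K) * frobSq (M * B - M.submatrix τ id * B') := by
  have hcol : ∀ A : Matrix (Fin n) (Fin m) ℝ, frobSq A = ∑ j, ∑ i, A i j ^ 2 :=
    fun A => Finset.sum_comm
  rw [hcol, hcol, Finset.mul_sum]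
  refine Finset.sum_le_sum fun j _ => ?_
  set δ : Fin p → ℝ := fun k => B' k j - B k j with hδ
  set g : Fin n → ℝ := fun i => (M * B - M.submatrix τ id * B) i j
  set t : Fin n → ℝ := fun i => (M * B - M.submatrix τ id * B') i j
  have hg : ∀ i, g i = t i + (M *ᵥ δ) (τ i) := by
    intro i
    simp only [g, t, hδ, Matrix.sub_apply, Matrix.mul_apply, Matrix.mulVec, dotProduct,
      Matrix.submatrix_apply, id, mul_sub, Finset.sum_sub_distrib]
    ring
  have hfix : ∀ i, τ i = i → (M *ᵥ δ) i ^ 2 = t i ^ 2 := by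
    intro i hi
    have h0 : g i = 0 := by simp [g, Matrix.mul_apply, hi]
    have h1 := hg i
    rw [h0, hi] at h1
    rw [eq_neg_of_add_eq_zero_left h1.symm]
    ring
  have h1 : ∑ i, g i ^ 2 ≤ 2 * ∑ i, t i ^ 2 + 2 * ∑ i, (M *ᵥ δ) (τ i) ^ 2 := by
    rw [Finset.mul_sum, Finset.mul_sum, ← Finset.sum_add_distrib]
    refine Finset.sum_le_sum fun i _ => ?_
    rw [hg]
    nlinarith [sq_nonneg (t i - (M *ᵥ δ) (τ i))]
  have h2 : ∑ i, (M *ᵥ δ) (τ i) ^ 2 = ∑ i, (M *ᵥ δ) i ^ 2 :=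
    Equiv.sum_comp τ fun i => (M *ᵥ δ) i ^ 2
  have h3 : ∑ i ∈ Finset.univ.filter fun i => τ i = i, (M *ᵥ δ) i ^ 2 ≤ ∑ i, t i ^ 2 := by
    rw [Finset.sum_congr rfl fun i hi => hfix i (Finset.mem_filter.1 hi).2]
    exact Finset.sum_le_sum_of_subset_of_nonneg (Finset.filter_subset _ _)
      fun _ _ _ => sq_nonneg _
  have h4 := (hM δ).trans (mul_le_mul_of_nonneg_left h3 hK)
  rw [h2] at h1
  linarith

end

/-! ### Comparison of a permutation with the true one -/

/-- Fubini bound by the measure of an exceptional set `bad`, which need not be measurable, and a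
uniform bound on the sections outside it. -/
lemma measureReal_prod_le {α β : Type*} [MeasurableSpace α] [MeasurableSpace β] (μ : Measure α)
    [IsProbabilityMeasure μ] (ν : Measure β) [IsProbabilityMeasure ν] {s : Set (α × β)}
    (hs : MeasurableSet s) {bad : Set α} {δ : ℝ} (hδ : 0 ≤ δ)
    (h : ∀ x ∉ bad, ν.real (Prod.mk x ⁻¹' s) ≤ δ) :
    (μ.prod ν).real s ≤ μ.real bad + δ := by
  have h1 : (μ.prod ν) s ≤ μ bad + ENNReal.ofReal δ :=
    calc (μ.prod ν) s = ∫⁻ x, ν (Prod.mk x ⁻¹' s) ∂μ := Measure.prod_apply hs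
      _ ≤ ∫⁻ x, ((toMeasurable μ bad).indicator 1 x + ENNReal.ofReal δ) ∂μ := by
        refine lintegral_mono fun x => ?_
        by_cases hx : x ∈ toMeasurable μ bad
        · simp only [hx, Set.indicator_of_mem, Pi.one_apply]
          exact prob_le_one.trans le_self_add
        · have hx' : x ∉ bad := fun hb => hx (subset_toMeasurable μ bad hb)
          simp only [hx, not_false_eq_true, Set.indicator_of_notMem, zero_add]
          rw [← ENNReal.ofReal_toReal (measure_ne_top ν (Prod.mk x ⁻¹' s))]
          exact ENNReal.ofReal_le_ofReal (h x hx')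
      _ = μ bad + ENNReal.ofReal δ := by
        rw [lintegral_add_right _ measurable_const,
          lintegral_indicator_one (measurableSet_toMeasurable _ _), measure_toMeasurable]
        simp
  have h2 := ENNReal.toReal_mono (by finiteness) h1
  rwa [ENNReal.toReal_add (by finiteness) (by finiteness), ENNReal.toReal_ofReal hδ] at h2

section

variable {n p m : ℕ}

/-- The event that the design permuted by `τ` fits the observation `x * B + σ z` at least as well
as the true design `x`. -/
def misfitEvent (τ : Equiv.Perm (Fin n)) (B : Matrix (Fin p) (Fin m) ℝ) (σ : ℝ) :
    Set (EuclideanSpace ℝ (Fin n × Fin p) × EuclideanSpace ℝ (Fin n × Fin m)) :=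
  {e | resid ((unvec e.1).submatrix τ id) (vec (unvec e.1 * B) + σ • e.2) ≤
    resid (unvec e.1) (vec (unvec e.1 * B) + σ • e.2)}

lemma measurableSet_misfitEvent (τ : Equiv.Perm (Fin n)) (B : Matrix (Fin p) (Fin m) ℝ) (σ : ℝ) :
    MeasurableSet (misfitEvent τ B σ) := by
  have h1 : Continuous fun e : EuclideanSpace ℝ (Fin n × Fin p) × EuclideanSpace ℝ (Fin n × Fin m)
      => unvec e.1 := continuous_matrix fun i j => by
    simp only [unvec_apply]
    fun_prop
  have h2 : Continuous fun e : EuclideanSpace ℝ (Fin n × Fin p) × EuclideanSpace ℝ (Fin n × Fin m)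
      => vec (unvec e.1 * B) + σ • e.2 := by
    refine Continuous.add ((PiLp.continuous_toLp 2 _).comp (continuous_pi fun e => ?_))
      (continuous_snd.const_smul σ)
    exact (h1.matrix_mul continuous_const).matrix_elem e.1 e.2
  exact measurableSet_le (measurable_resid (h1.matrix_submatrix τ id) h2) (measurable_resid h1 h2)

/-- The failure probability for a single competitor `τ`: the terms `exp (-n)` come from the singular
values of the design, one of the other three from the displacement of the signal and two from the
noise. -/
lemma prod_stdGaussian_real_misfitEvent_le {τ : Equiv.Perm (Fin n)} (hτ : τ ≠ 1)
    (hd : 4 * ((Finset.univ.filter fun i => τ i ≠ i).card : ℝ) ≤ n) (hp : 2 * (p : ℝ) ≤ n)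
    {B : Matrix (Fin p) (Fin m) ℝ} (hB : 0 < opNorm B) (hm : 1 ≤ m) {σ : ℝ} (hσ : 0 < σ)
    (hsnr : 2000 * (1 + Real.exp 36) * (m * σ ^ 2) ≤ frobSq B) :
    ((stdGaussian (EuclideanSpace ℝ (Fin n × Fin p))).prod
      (stdGaussian (EuclideanSpace ℝ (Fin n × Fin m)))).real (misfitEvent τ B σ) ≤
      2 * Real.exp (-n) +
      3 * Real.exp (-((Finset.univ.filter fun i => τ i ≠ i).card * stableRank B / 24)) := by
  set d := (Finset.univ.filter fun i => τ i ≠ i).card with hd_def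
  have hd1 : 1 ≤ d := by
    rw [hd_def, Nat.one_le_iff_ne_zero, Finset.card_ne_zero]
    by_contra hne
    rw [Finset.not_nonempty_iff_eq_empty, Finset.filter_eq_empty_iff] at hne
    exact hτ (Equiv.ext fun i => by simpa using hne (Finset.mem_univ i))
  have hd1' : (1 : ℝ) ≤ d := mod_cast hd1
  have hm1' : (1 : ℝ) ≤ m := mod_cast hm
  have hdm : (1 : ℝ) ≤ d * m := one_le_mul_of_one_le_of_one_le hd1' hm1'
  have hρm : stableRank B ≤ m :=
    (stableRank_le_rank B).trans (mod_cast (B.rank_le_width))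
  have hρ0 : 0 ≤ stableRank B := div_nonneg (by rw [frobSq]; positivity) (sq_nonneg _)
  have hdρ : (d : ℝ) * stableRank B / 24 ≤ d * m := by
    have := mul_le_mul_of_nonneg_left hρm (Nat.cast_nonneg d : (0 : ℝ) ≤ d)
    have := mul_nonneg (Nat.cast_nonneg d : (0 : ℝ) ≤ d) hρ0
    linarith
  set R := Finset.univ.filter fun i => τ i = i with hRdef
  have hR : 3 * (n : ℝ) ≤ 4 * R.card := by
    have h1 : R.card + d = n := by
      rw [hRdef, hd_def, Finset.card_filter_add_card_filter_not]
      simp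
    have h2 : (R.card : ℝ) + d = n := mod_cast h1
    linarith
  let bad₁ : Set (EuclideanSpace ℝ (Fin n × Fin p)) :=
    {x | ¬ ∀ v : Fin p → ℝ, ∑ i, (unvec x *ᵥ v) i ^ 2 ≤
        Real.exp 36 * ∑ i ∈ R, (unvec x *ᵥ v) i ^ 2}
  let bad₂ : Set (EuclideanSpace ℝ (Fin n × Fin p)) :=
    {x | ¬ (d : ℝ) / 6 * frobSq B ≤ frobSq (unvec x * B - (unvec x).submatrix τ id * B)}
  have hslice : ∀ x ∉ bad₁ ∪ bad₂,
      (stdGaussian (EuclideanSpace ℝ (Fin n × Fin m))).real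
        (Prod.mk x ⁻¹' misfitEvent τ B σ) ≤ 2 * Real.exp (-(d * stableRank B / 24)) := by
    intro x hx
    simp only [bad₁, bad₂, Set.mem_union, Set.mem_ofPred_eq, not_or, not_not] at hx
    obtain ⟨hx₁, hx₂⟩ := hx
    set M := unvec x
    set U := LinearMap.range (fitMap m (M.submatrix τ id))
    obtain ⟨B', hB'⟩ := U.starProjection_apply_mem (vec (M * B))
    -- `2000 / (6 * 2) > 166`, the factor `1 + e ^ 36` being the loss in `frobSq_sub_le_mul_frobSq`
    have hT : 166 * (d * m) * σ ^ 2 ≤ ‖vec (M * B) - U.starProjection (vec (M * B))‖ ^ 2 := by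
      have h1 : ‖vec (M * B) - U.starProjection (vec (M * B))‖ ^ 2
          = frobSq (M * B - M.submatrix τ id * B') := by
        rw [← hB', ← norm_vec_sq]
        rfl
      have h2 := hx₂.trans (frobSq_sub_le_mul_frobSq (Real.exp_pos 36).le hx₁ B B')
      rw [← h1] at h2
      have h3 := mul_le_mul_of_nonneg_left hsnr (by positivity : (0 : ℝ) ≤ d / 6)
      have h4 : 0 < 2 * (1 + Real.exp 36) := by positivity
      refine le_of_mul_le_mul_left (le_trans ?_ (h3.trans h2)) h4
      have h5 : 0 ≤ (1 + Real.exp 36) * (d * m * σ ^ 2) := by positivity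
      linarith
    have hTpos : 0 < ‖vec (M * B) - U.starProjection (vec (M * B))‖ := by
      by_contra hle
      have h0 : ‖vec (M * B) - U.starProjection (vec (M * B))‖ = 0 :=
        le_antisymm (not_lt.1 hle) (norm_nonneg _)
      rw [h0] at hT
      have : 0 < 166 * (d * m) * σ ^ 2 := by positivity
      norm_num at hT
      linarith
    have hrank : Module.finrank ℝ U ≤
        Module.finrank ℝ ↥(U ⊓ LinearMap.range (fitMap m M)) + d * m :=
      (finrank_range_le_inf_add _ _).trans
        (Nat.add_le_add_left (finrank_range_fitMap_sub_le M τ) _)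
    refine (stdGaussian_real_infDist_le U (LinearMap.range (fitMap m M))
      (θ := vec (M * B)) ⟨B, rfl⟩ hσ hrank hTpos).trans ?_
    have hlog := Real.log_two_lt_d9
    have hTσ : ∀ c : ℝ, 0 < c → 166 * (d * m) / c ≤
        ‖vec (M * B) - U.starProjection (vec (M * B))‖ ^ 2 / (c * σ ^ 2) := by
      intro c hc
      rw [div_le_div_iff₀ hc (by positivity)]
      have := mul_le_mul_of_nonneg_left hT hc.le
      linarith
    rw [two_mul]
    refine add_le_add (Real.exp_le_exp.2 ?_) (Real.exp_le_exp.2 ?_)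
    · have := hTσ 64 (by norm_num)
      linarith
    · have := hTσ 8 (by norm_num)
      push_cast
      nlinarith
  refine (measureReal_prod_le _ _ (measurableSet_misfitEvent τ B σ) (by positivity)
    hslice).trans ?_
  have h1 : (stdGaussian (EuclideanSpace ℝ (Fin n × Fin p))).real bad₁ ≤ 2 * Real.exp (-n) :=
    stdGaussian_real_not_sum_mulVec_sq_le R hR hp
  have h2 : (stdGaussian (EuclideanSpace ℝ (Fin n × Fin p))).real bad₂ ≤
      Real.exp (-(d * stableRank B / 24)) := stdGaussian_real_not_le_frobSq_sub τ B hB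
  have h3 := measureReal_union_le (μ := stdGaussian (EuclideanSpace ℝ (Fin n × Fin p))) bad₁ bad₂
  linarith

end

/-! ### Reduction to standard Gaussian vectors -/

section

variable {n p m : ℕ} {Ω : Type*} [MeasurableSpace Ω] {P : Measure Ω}
  {σ : ℝ≥0} {X : Ω → Matrix (Fin n) (Fin p) ℝ} {W : Ω → Matrix (Fin n) (Fin m) ℝ}

lemma IsGaussianDesign.submatrix (h : IsGaussianDesign P σ X W) (π : Equiv.Perm (Fin n)) :
    IsGaussianDesign P σ (fun ω => (X ω).submatrix π id) W where
  indep := by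
    have hinj : Function.Injective
        (Sum.map (Prod.map π id) id :
          (Fin n × Fin p) ⊕ (Fin n × Fin m) → (Fin n × Fin p) ⊕ (Fin n × Fin m)) :=
      Sum.map_injective.2 ⟨π.injective.prodMap Function.injective_id, Function.injective_id⟩
    convert h.indep.precomp hinj using 1
    ext k ω
    rcases k with k | k <;> rfl
  law_X i j := h.law_X (π i) j
  law_W := h.law_W

variable [IsProbabilityMeasure P]

/-- The design and the rescaled noise are independent standard Gaussian vectors. -/
lemma IsGaussianDesign.hasLaw (hσ : 0 < σ) (h : IsGaussianDesign P σ X W) :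
    HasLaw (fun ω => (vec (X ω), (σ : ℝ)⁻¹ • vec (W ω)))
      ((stdGaussian (EuclideanSpace ℝ (Fin n × Fin p))).prod
        (stdGaussian (EuclideanSpace ℝ (Fin n × Fin m)))) P := by
  let c : (Fin n × Fin p) ⊕ (Fin n × Fin m) → ℝ := Sum.elim (fun _ => 1) fun _ => (σ : ℝ)⁻¹
  let f : (Fin n × Fin p) ⊕ (Fin n × Fin m) → Ω → ℝ := fun k ω =>
    c k * Sum.elim (fun e => X ω e.1 e.2) (fun e => W ω e.1 e.2) k
  have hσ' : (σ : ℝ) ≠ 0 := by positivity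
  have hf : ∀ k, HasLaw (f k) (gaussianReal 0 1) P := by
    rintro (e | e)
    · simpa [f, c] using h.law_X e.1 e.2
    · have h1 := gaussianReal_const_mul (h.law_W e.1 e.2) (σ : ℝ)⁻¹
      have h2 : NNReal.mk ((σ : ℝ)⁻¹ ^ 2) (sq_nonneg _) * σ ^ 2 = 1 := by
        ext
        push_cast
        field_simp
      rw [mul_zero] at h1
      rw [← h2]
      exact h1
  have hind : iIndepFun f P :=
    h.indep.comp (fun k x => c k * x) fun k => measurable_const_mul (c k)
  have hmap := (iIndepFun_iff_map_fun_eq_pi_map fun k => (hf k).aemeasurable).1 hind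
  have hmeas : AEMeasurable (fun ω k => f k ω) P :=
    aemeasurable_pi_lambda _ fun k => (hf k).aemeasurable
  have hlaw : HasLaw (fun ω k => f k ω) (Measure.pi fun _ => gaussianReal 0 1) P :=
    ⟨hmeas, by rw [hmap]; simp_rw [(hf _).map_eq]⟩
  have hsplit : HasLaw
      (Prod.map (WithLp.toLp 2) (WithLp.toLp 2) ∘ MeasurableEquiv.sumPiEquivProdPi fun _ => ℝ)
      ((stdGaussian (EuclideanSpace ℝ (Fin n × Fin p))).prod
        (stdGaussian (EuclideanSpace ℝ (Fin n × Fin m))))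
      (Measure.pi fun _ : (Fin n × Fin p) ⊕ (Fin n × Fin m) => gaussianReal 0 1) := by
    have hm : Measurable (Prod.map (WithLp.toLp 2) (WithLp.toLp 2) :
        (Fin n × Fin p → ℝ) × (Fin n × Fin m → ℝ) →
          EuclideanSpace ℝ (Fin n × Fin p) × EuclideanSpace ℝ (Fin n × Fin m)) := by fun_prop
    refine ⟨(hm.comp (MeasurableEquiv.measurable _)).aemeasurable, ?_⟩
    rw [← Measure.map_map hm (MeasurableEquiv.measurable _),
      (measurePreserving_sumPiEquivProdPi fun _ => gaussianReal 0 1).map_eq,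
      ← Measure.map_prod_map _ _ (by fun_prop) (by fun_prop), map_pi_eq_stdGaussian,
      map_pi_eq_stdGaussian]
  have hcomp := hsplit.comp hlaw
  refine hcomp.congr (Filter.Eventually.of_forall fun ω => ?_)
  refine Prod.ext ?_ ?_
  · ext e
    simp [f, c, vec, MeasurableEquiv.sumPiEquivProdPi, Equiv.sumPiEquivProdPi]
  · ext e
    simp [f, c, vec, MeasurableEquiv.sumPiEquivProdPi, Equiv.sumPiEquivProdPi]

lemma IsGaussianDesign.real_resid_le_eq (hσ : 0 < σ) (h : IsGaussianDesign P σ X W)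
    (B : Matrix (Fin p) (Fin m) ℝ) (τ : Equiv.Perm (Fin n)) :
    P.real {ω | resid ((X ω).submatrix τ id) (vec (X ω * B + W ω)) ≤
      resid (X ω) (vec (X ω * B + W ω))} =
    ((stdGaussian (EuclideanSpace ℝ (Fin n × Fin p))).prod
      (stdGaussian (EuclideanSpace ℝ (Fin n × Fin m)))).real (misfitEvent τ B σ) := by
  have hlaw := h.hasLaw hσ
  rw [← hlaw.map_eq, map_measureReal_apply_of_aemeasurable hlaw.aemeasurable
    (measurableSet_misfitEvent τ B σ)]
  congr 1
  ext ω
  have h1 : vec (X ω * B + W ω) = vec (X ω * B) + (σ : ℝ) • ((σ : ℝ)⁻¹ • vec (W ω)) := by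
    rw [smul_smul, mul_inv_cancel₀ (by positivity), one_smul]
    rfl
  simp only [misfitEvent, Set.mem_preimage, Set.mem_ofPred_eq, unvec_vec, h1]

end

/-! ### The union bound over permutations -/

/-- A weighted count of permutations by the number of moved points, obtained by enlarging the sum
to all self-maps, where it factorizes. -/
lemma sum_pow_card_moved_le {n : ℕ} {q : ℝ} (hq : 0 ≤ q) :
    ∑ τ : Equiv.Perm (Fin n), q ^ (Finset.univ.filter fun i => τ i ≠ i).card ≤ (1 + n * q) ^ n := by
  let g : Fin n → Fin n → ℝ := fun i j => if j ≠ i then q else 1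
  have hg : ∀ i j, 0 ≤ g i j := by
    intro i j
    simp only [g]
    split_ifs <;> positivity
  have h1 : ∀ τ : Equiv.Perm (Fin n),
      q ^ (Finset.univ.filter fun i => τ i ≠ i).card = ∏ i, g i (τ i) := by
    intro τ
    simp only [g]
    rw [Finset.prod_ite, Finset.prod_const, Finset.prod_const_one, mul_one]
  have h2 : ∑ τ : Equiv.Perm (Fin n), ∏ i, g i (τ i) ≤ ∑ f : Fin n → Fin n, ∏ i, g i (f i) := by
    rw [← Finset.sum_image (f := fun f : Fin n → Fin n => ∏ i, g i (f i))
      (g := fun τ : Equiv.Perm (Fin n) => (τ : Fin n → Fin n))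
      (DFunLike.coe_injective.injOn)]
    exact Finset.sum_le_sum_of_subset_of_nonneg (Finset.subset_univ _)
      fun f _ _ => Finset.prod_nonneg fun i _ => hg i _
  have h3 : ∑ f : Fin n → Fin n, ∏ i, g i (f i) = ∏ i, ∑ j, g i j := by
    rw [Finset.prod_univ_sum, Fintype.piFinset_univ]
  have h4 : ∀ i, ∑ j, g i j ≤ 1 + n * q := by
    intro i
    have : ∀ j, g i j ≤ (if j = i then 1 else 0) + q := by
      intro j
      simp only [g]
      by_cases hj : j = i <;> simp [hj, hq]
    refine (Finset.sum_le_sum fun j _ => this j).trans (le_of_eq ?_)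
    rw [Finset.sum_add_distrib]
    simp
  simp_rw [h1]
  rw [h3] at h2
  refine h2.trans ?_
  refine (Finset.prod_le_prod (fun i _ => Finset.sum_nonneg fun j _ => hg i j)
    fun i _ => h4 i).trans (le_of_eq ?_)
  simp

lemma sum_pow_card_moved_erase_one_le {n : ℕ} {q : ℝ} (hq : 0 ≤ q) (hnq : n ^ 2 * q ≤ 1) :
    ∑ τ ∈ Finset.univ.erase (1 : Equiv.Perm (Fin n)),
      q ^ (Finset.univ.filter fun i => τ i ≠ i).card ≤ 2 * (n ^ 2 * q) := by
  have h1 := sum_pow_card_moved_le (n := n) hq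
  rw [← Finset.add_sum_erase _ _ (Finset.mem_univ (1 : Equiv.Perm (Fin n)))] at h1
  have h2 : (1 + n * q) ^ n ≤ Real.exp (n ^ 2 * q) := by
    have h3 : 1 + n * q ≤ Real.exp (n * q) := by linarith [Real.add_one_le_exp (n * q)]
    refine (pow_le_pow_left₀ (by positivity) h3 n).trans (le_of_eq ?_)
    rw [← Real.exp_nat_mul]
    congr 1
    ring
  have h0 : 0 ≤ (n : ℝ) ^ 2 * q := by positivity
  have h3 := Real.abs_exp_sub_one_le (x := n ^ 2 * q) (by rwa [abs_of_nonneg h0])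
  rw [abs_of_nonneg h0] at h3
  have h4 := (le_abs_self _).trans h3
  simp only [Equiv.Perm.coe_one, id_eq, ne_eq, not_true_eq_false, Finset.filter_false,
    Finset.card_empty, pow_zero] at h1
  linarith

lemma card_moved_inv_mul {n : ℕ} (π₀ π : Equiv.Perm (Fin n)) :
    (Finset.univ.filter fun i => (π₀⁻¹ * π) i ≠ i).card = hammingDist (⇑π) (⇑π₀) := by
  rw [hammingDist]
  congr 1
  ext i
  rw [Finset.mem_filter, Finset.mem_filter, Equiv.Perm.mul_apply, ne_eq, ne_eq,
    Equiv.Perm.inv_eq_iff_eq]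

end PermRegression

theorem theorem4 :
    ∃ c₀ c₁ c₃ c₄ : ℝ, 0 < c₀ ∧ 0 < c₁ ∧ 0 < c₃ ∧ 0 < c₄ ∧
      ∀ ε : ℝ, 0 < ε → ∃ N₂ : ℝ, 0 < N₂ ∧
        ∀ (n p m h_max : ℕ) (σ : ℝ≥0) (B : Matrix (Fin p) (Fin m) ℝ)
          (π : Equiv.Perm (Fin n))
          {Ω : Type*} [MeasurableSpace Ω] (P : Measure Ω) [IsProbabilityMeasure P]
          (X : Ω → Matrix (Fin n) (Fin p) ℝ) (W : Ω → Matrix (Fin n) (Fin m) ℝ),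
          N₂ < (n : ℝ) → 2 * p ≤ n → 0 < σ →
          PermRegression.IsGaussianDesign P σ X W →
          hammingDist (⇑(1 : Equiv.Perm (Fin n))) (⇑π) ≤ h_max →
          (h_max : ℝ) * (B.rank : ℝ) ≤ (n : ℝ) / 8 →
          c₀ < PermRegression.snr B σ →
          c₁ * (1 + ε) * Real.log n ≤ PermRegression.stableRank B →
          c₃ * (1 + ε) * Real.log n / PermRegression.stableRank B + c₄
            ≤ Real.log (PermRegression.snr B σ) →
          1 - 10 * (n : ℝ) ^ (-ε) * max (((n : ℝ) ^ ε - 1)⁻¹) 1 ≤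
            P.real {ω | PermRegression.restrictedMLPerms h_max (X ω)
              (PermRegression.observe π (X ω) B (W ω)) = {π}} := by
  open PermRegression in
  refine ⟨2000 * (1 + Real.exp 36), 72, 1, 1, by positivity, by norm_num, one_pos, one_pos,
    fun ε hε => ⟨3, by norm_num, ?_⟩⟩
  intro n p m h_max σ B π₀ Ω _ P _ X W hn hp hσ hdesign hπ₀ hrank hsnr hρ _
  have hn0 : (0 : ℝ) < n := by linarith
  have hlogn : 1 ≤ Real.log n := by
    rw [Real.le_log_iff_exp_le hn0]
    linarith [Real.exp_one_lt_d9]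
  set Λ := (1 + ε) * Real.log n with hΛ
  have hΛ1 : 1 ≤ Λ := one_le_mul_of_one_le_of_one_le (by linarith) hlogn
  rw [mul_assoc, ← hΛ] at hρ
  have hp' : 2 * (p : ℝ) ≤ n := mod_cast hp
  have hσ' : (0 : ℝ) < σ := hσ
  have hB : 0 < opNorm B := by
    refine lt_of_le_of_ne (opNorm_nonneg B) fun h0 => ?_
    rw [stableRank, ← h0] at hρ
    norm_num at hρ
    linarith
  have hm : 1 ≤ m := by
    by_contra hm0
    have : m = 0 := by omega
    subst this
    rw [snr] at hsnr
    norm_num at hsnr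
    linarith [Real.exp_pos 36]
  have hsnr' : 2000 * (1 + Real.exp 36) * (m * (σ : ℝ) ^ 2) ≤ frobSq B := by
    have : (0 : ℝ) < m * (σ : ℝ) ^ 2 := by positivity
    rw [snr, lt_div_iff₀ this] at hsnr
    exact hsnr.le
  -- up to the factor `5`, each moved point contributes a factor `q` to the failure probability
  set q := Real.exp (-(3 * Λ)) with hq
  have hhΛ : (h_max : ℝ) * (72 * Λ) ≤ n / 8 :=
    (mul_le_mul_of_nonneg_left (hρ.trans (stableRank_le_rank B)) (Nat.cast_nonneg _)).trans hrank
  set X' : Ω → Matrix (Fin n) (Fin p) ℝ := fun ω => (X ω).submatrix π₀ id with hX'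
  -- after relabelling the rows of the design the true permutation is the identity
  have hdesign' : IsGaussianDesign P σ X' W := hdesign.submatrix π₀
  let fail : Equiv.Perm (Fin n) → Set Ω := fun τ =>
    {ω | resid ((X' ω).submatrix τ id) (vec (X' ω * B + W ω)) ≤
      resid (X' ω) (vec (X' ω * B + W ω))}
  have hfail : ∀ π ∈ hammingBall n h_max, π ≠ π₀ → P.real (fail (π₀⁻¹ * π)) ≤
      5 * q ^ (Finset.univ.filter fun i => (π₀⁻¹ * π) i ≠ i).card := by
    intro π hπ hne
    set τ := π₀⁻¹ * π with hτ
    have hτ1 : τ ≠ 1 := fun h1 => hne (inv_mul_eq_one.1 h1).symm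
    have hd : ((Finset.univ.filter fun i => τ i ≠ i).card : ℝ) ≤ 2 * h_max := by
      have h1 := hammingDist_triangle (⇑π) (⇑(1 : Equiv.Perm (Fin n))) (⇑π₀)
      rw [← card_moved_inv_mul, ← hτ, hammingDist_comm] at h1
      have h2 : hammingDist (⇑(1 : Equiv.Perm (Fin n))) (⇑π) ≤ h_max := hπ
      exact_mod_cast (by omega : (Finset.univ.filter fun i => τ i ≠ i).card ≤ 2 * h_max)
    set d := (Finset.univ.filter fun i => τ i ≠ i).card
    have hdΛ : (d : ℝ) * (72 * Λ) ≤ n / 4 := by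
      have := mul_le_mul_of_nonneg_right hd (by positivity : 0 ≤ 72 * Λ)
      linarith
    have hd0 : (0 : ℝ) ≤ d := Nat.cast_nonneg d
    have hdle : (d : ℝ) ≤ d * Λ := le_mul_of_one_le_right hd0 hΛ1
    have hqd : q ^ d = Real.exp (-(3 * (d * Λ))) := by
      rw [hq, ← Real.exp_nat_mul]
      congr 1
      ring
    rw [hdesign'.real_resid_le_eq hσ B τ]
    refine (prod_stdGaussian_real_misfitEvent_le hτ1 (by linarith) hp' hB hm hσ' hsnr').trans ?_
    have h1 : Real.exp (-(n : ℝ)) ≤ q ^ d := by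
      rw [hqd]
      exact Real.exp_le_exp.2 (by linarith)
    have h2 : Real.exp (-(d * stableRank B / 24)) ≤ q ^ d := by
      rw [hqd]
      have := mul_le_mul_of_nonneg_left hρ hd0
      exact Real.exp_le_exp.2 (by linarith)
    linarith
  have hq2 : (n : ℝ) ^ 2 * q ≤ (n : ℝ) ^ (-ε) := by
    rw [Real.rpow_def_of_pos hn0, hq, ← Real.exp_log hn0, ← Real.exp_nat_mul, ← Real.exp_add,
      Real.log_exp]
    refine Real.exp_le_exp.2 ?_
    have : 0 ≤ ε * Real.log n := by positivity
    rw [hΛ]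
    push_cast
    linarith
  have hnε : (n : ℝ) ^ (-ε) ≤ 1 := Real.rpow_le_one_of_one_le_of_nonpos (by linarith) (by linarith)
  have hq0 : 0 ≤ q := (Real.exp_pos _).le
  classical
  set S := Finset.univ.filter fun π => π ∈ hammingBall n h_max ∧ π ≠ π₀ with hS
  have hunion : P.real (⋃ π ∈ S, fail (π₀⁻¹ * π)) ≤ 10 * (n : ℝ) ^ (-ε) :=
    calc P.real (⋃ π ∈ S, fail (π₀⁻¹ * π))
        ≤ ∑ π ∈ S, P.real (fail (π₀⁻¹ * π)) := measureReal_biUnion_finset_le _ _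
      _ ≤ ∑ π ∈ S, 5 * q ^ (Finset.univ.filter fun i => (π₀⁻¹ * π) i ≠ i).card :=
        Finset.sum_le_sum fun π hπ => by
          rw [hS, Finset.mem_filter] at hπ
          exact hfail π hπ.2.1 hπ.2.2
      _ = ∑ τ ∈ S.image fun π => π₀⁻¹ * π,
            5 * q ^ (Finset.univ.filter fun i => τ i ≠ i).card := by
        rw [Finset.sum_image fun _ _ _ _ h => mul_left_cancel h]
      _ ≤ ∑ τ ∈ Finset.univ.erase (1 : Equiv.Perm (Fin n)),
            5 * q ^ (Finset.univ.filter fun i => τ i ≠ i).card := by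
        refine Finset.sum_le_sum_of_subset_of_nonneg ?_ fun _ _ _ => by positivity
        intro τ hτ
        obtain ⟨π, hπ, rfl⟩ := Finset.mem_image.1 hτ
        rw [hS, Finset.mem_filter] at hπ
        exact Finset.mem_erase.2 ⟨fun h1 => hπ.2.2 (inv_mul_eq_one.1 h1).symm, Finset.mem_univ _⟩
      _ ≤ 5 * (2 * (n ^ 2 * q)) := by
        rw [← Finset.mul_sum]
        exact mul_le_mul_of_nonneg_left
          (sum_pow_card_moved_erase_one_le hq0 (hq2.trans hnε)) (by norm_num)
      _ ≤ 10 * (n : ℝ) ^ (-ε) := by linarith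
  have hcover : (Set.univ : Set Ω) ⊆ {ω | restrictedMLPerms h_max (X ω)
      (observe π₀ (X ω) B (W ω)) = {π₀}} ∪ ⋃ π ∈ S, fail (π₀⁻¹ * π) := by
    intro ω _
    by_cases hω : ω ∈ ⋃ π ∈ S, fail (π₀⁻¹ * π)
    · exact Or.inr hω
    left
    refine restrictedMLPerms_eq_singleton hπ₀ fun π hπ hne => ?_
    by_contra hle
    refine hω (Set.mem_biUnion (x := π) (by simp [hS, hπ, hne]) ?_)
    have h1 : (X' ω).submatrix (π₀⁻¹ * π) id = (X ω).submatrix π id := by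
      ext i j
      simp [hX']
    have h2 : observe π₀ (X ω) B (W ω) = X' ω * B + W ω := by
      rw [observe, permMatrix_mul_eq_submatrix]
    rw [h2] at hle
    simp only [fail, Set.mem_ofPred_eq]
    rw [h1]
    exact not_lt.1 hle
  have htotal := (measureReal_mono (μ := P) hcover).trans (measureReal_union_le _ _)
  rw [probReal_univ] at htotal
  have hmax : 10 * (n : ℝ) ^ (-ε) * 1 ≤ 10 * (n : ℝ) ^ (-ε) * max (((n : ℝ) ^ ε - 1)⁻¹) 1 :=
    mul_le_mul_of_nonneg_left (le_max_right _ _) (by positivity)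
  linarith
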